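/- **Setting.** Let $m,k_{\mathrm{enum}},k_{\mathrm{fft}},k_{\mathrm{lat}}\ge 0$, $n=k_{\mathrm{enum}}+k_{\mathrm{fft}}+k_{\mathrm{lat}}$, $1\le p\le q$, $D\ge 1$ be integers, let $C>0$ and $0<\eta\le 1$ be real, let $\chi_s,\chi_e$ be probability distributions on $\mathbb Z_q$ with standard deviations $\sigma_s,\sigma_e$ (computed on representatives centered at $0$), $\alpha=\sigma_e/\sigma_s$, and let $A=[A_{\mathrm{enum}}\ A_{\mathrm{fft}}\ A_{\mathrm{lat}}]\in\mathbb Z_q^{m\times n}$ and $b\in\mathbb Z_q^m$. Let $L$ be a fixed list of $D$ vectors $(\alpha x_j,\,y_{j,\mathrm{lat}})$, with $x_j\in\mathbb Z^m$ and $y_{j,\mathrm{lat}}\in\mathbb Z^{k_{\mathrm{lat}}}$, of the lattice generated by the columns of $\begin{pmatrix}\alpha I_m&0\\A_{\mathrm{lat}}^T&qI_{k_{\mathrm{lat}}}\end{pmatrix}$ (the output of the sampling step). Elements of $\mathbb Z_q$ and $\mathbb Z_p$ are lifted to the representatives centered at $0$. Put $y_{j,\mathrm{enum}}=x_j^TA_{\mathrm{enum}}$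 and $y_{j,\mathrm{fft}}=x_j^TA_{\mathrm{fft}}$ modulo $q$. With $q'=q/\gcd(p,q)$, let $c_{q'}=0$ if $q'$ is odd and $c_{q'}=1/(2q')$ if $q'$ is even, and for $s_{\mathrm{fft}}\in\mathbb Z_p^{k_{\mathrm{fft}}}$ let $\psi(s_{\mathrm{fft}})=\exp\big(\tfrac{2\pi i\,c_{q'}}{p}\sum_t s_{\mathrm{fft},t}\big)$. For $s_{\mathrm{enum}}\in\mathbb Z_q^{k_{\mathrm{enum}}}$ define $$F_L(s_{\mathrm{enum}},s_{\mathrm{fft}})=\Re\Big(\tfrac1{\psi(s_{\mathrm{fft}})}\sum_{j}\exp\Big(\tfrac{2\pi i}{p}\big(\lfloor\tfrac pq y_{j,\mathrm{fft}}\rceil^T s_{\mathrm{fft}}+\tfrac pq y_{j,\mathrm{enum}}^Ts_{\mathrm{enum}}-\tfrac pq x_j^Tb\big)\Big)\Big),$$ $$S_x^L=\{s_{\mathrm{enum}}\in\mathbb Z_q^{k_{\mathrm{enum}}}:\exists\, s_{\mathrm{fft}}\in\mathbb Z_p^{k_{\mathrm{fft}}},\ F_L(s_{\mathrm{enum}},s_{\mathrm{fft}})>x\}\qquad(x>0).$$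 **The quantum dual attack, after the list $L$ has been sampled.** Quantum algorithms are unitary circuits on a finite register followed by a measurement in the computational basis; the last step is a classical loop that evaluates such circuits. 1. *Inner oracle $\hat{\mathcal O}(s_{\mathrm{enum}},s_{\mathrm{fft}})$.* Let $\theta$ satisfy $\psi(s_{\mathrm{fft}})=e^{-2\pi i\theta/p}$, let $w_j=\big(\tfrac pq y_{j,\mathrm{enum}},\lfloor\tfrac pq y_{j,\mathrm{fft}}\rceil,\theta-\tfrac pq x_j^Tb\big)$ and $\gamma_j=\cos\big(\tfrac{2\pi}p\langle w_j,(s_{\mathrm{enum}},s_{\mathrm{fft}},1)\rangle\big)$. Estimate $\frac1D\sum_j\gamma_j$ with precision $\varepsilon=\tfrac CD\eta$ and failure probability $\delta=\tfrac1{10}$ as follows. Prepare $D^{-1/2}\sum_j|j\rangle(\sqrt{\gamma_j}|1\rangle+\sqrt{1-\gamma_j}|0\rangle)$ (no rotation where $\gamma_j<0$), and estimate the probability $a^+$ of the flag $1$ by amplitude estimation with $\lceil 10000/\varepsilon\rceil+1$ points (phase estimation for the Grover iterate by an exact quantum Fourier transform, estimate $\sin^2(\pi y/M)$). Do the same for $-\gamma_j$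 and subtract. Take the median of $2\lceil\ln(1/\delta)\rceil+1$ runs. Return $1$ if it is $>(1+\eta)\tfrac CD$ and $0$ otherwise. 2. *Quantum search with bounded-error oracle $B$ over $N$ indices and confidence parameter $t$.* Stage $0$ evaluates the majority of $2t+1$ runs of $B$ in uniform superposition over the indices and stores it as a flag. Stage $k\ge1$ applies one round of amplitude amplification of the flag to stage $k-1$ and keeps the flag only if the majority of $2(t+k)+1$ fresh runs of $B$ is $1$. Each stage $0,\dots,\lceil\log_9N\rceil$ is run $40$ times; return the first flagged index, or $\bot$ if there is none. 3. *Outer oracle $\mathcal O(s_{\mathrm{enum}})$.* Search as in 2, with $t=10$, for $s_{\mathrm{fft}}\in\mathbb Z_p^{k_{\mathrm{fft}}}$ using $\hat{\mathcal O}(s_{\mathrm{enum}},\cdot)$; return $1$ if an index is found and $0$ otherwise. 4. *Guessing.* List $\mathbb Z_q^{k_{\mathrm{enum}}}$ in an order of non-increasing probability under $\chi_s^{k_{\mathrm{enum}}}$ (ties broken arbitrarily). For $k=0,1,\dots,\lceil\log_2q^{k_{\mathrm{enum}}}\rceil$, search as in 2, with $t=10+k$ and oracle $\mathcal O$, among the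 first $\min(2^k,q^{k_{\mathrm{enum}}})$ guesses; return the first guess that is found. If none is found, return $\bot$. **Theorem.** With probability at least $9/10$, the quantum dual attack returns a value in $S_C^L\cup\{\bot\}$. Furthermore, if $S_{(1+2\eta)C}^L\neq\varnothing$, then it returns a value in $S_C^L$ with probability at least $9/10$. -/

import Mathlib

open scoped Matrix

noncomputable section

/-! ### Unitary gates on finite registers -/

namespace QGate

variable {V W : Type} [Fintype V] [DecidableEq V] [Fintype W] [DecidableEq W]

/-- `G ⊗ H`, acting independently on two registers. -/
def tensor (G : Matrix.unitaryGroup W ℂ) (H : Matrix.unitaryGroup V ℂ) :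
    Matrix.unitaryGroup (W × V) ℂ :=
  ⟨Matrix.kronecker (G : Matrix W W ℂ) (H : Matrix V V ℂ),
    Matrix.kronecker_mem_unitary G.2 H.2⟩

/-- The controlled gate `|w⟩|v⟩ ↦ |w⟩ (G w |v⟩)`. -/
def ctrl (G : W → Matrix.unitaryGroup V ℂ) : Matrix.unitaryGroup (W × V) ℂ :=
  ⟨Matrix.of fun a b => if a.1 = b.1 then (G a.1 : Matrix V V ℂ) a.2 b.2 else 0, by
    rw [Matrix.mem_unitaryGroup_iff]
    ext ⟨w, v⟩ ⟨w', v'⟩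
    have h := congrFun (congrFun (Matrix.mem_unitaryGroup_iff.mp (G w).2) v) v'
    simp only [Matrix.mul_apply, Matrix.star_apply] at h
    simp only [Matrix.mul_apply, Matrix.star_apply, Matrix.of_apply, Fintype.sum_prod_type]
    by_cases hw : w = w'
    · subst hw
      rw [Finset.sum_eq_single w]
      · simpa [Matrix.one_apply] using h
      · intro u _ hu
        simp [Ne.symm hu]
      · simp
    · rw [Matrix.one_apply_ne (by simp [hw])]
      refine Finset.sum_eq_zero fun u _ => Finset.sum_eq_zero fun y _ => ?_
      by_cases h1 : w = u
      · subst h1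
        simp [Ne.symm hw]
      · simp [h1]⟩

/-- The phase flip `|w⟩ ↦ -|w⟩` if `f w`, and `|w⟩ ↦ |w⟩` otherwise. -/
def flip (f : W → Bool) : Matrix.unitaryGroup W ℂ :=
  ⟨Matrix.diagonal fun w => if f w then -1 else 1, by
    rw [Matrix.mem_unitaryGroup_iff, Matrix.star_eq_conjTranspose,
      Matrix.diagonal_conjTranspose, Matrix.diagonal_mul_diagonal, ← Matrix.diagonal_one]
    congr 1
    funext w
    by_cases h : f w <;> simp [h]⟩

/-- The positive controlled rotation
`|0⟩ ↦ √a |1⟩ + √(1 - a) |0⟩` for `0 ≤ a ≤ 1`, and `|0⟩ ↦ |0⟩` for `a < 0`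
(the case `a > 1` does not occur below). -/
def rot (a : ℝ) : Matrix.unitaryGroup Bool ℂ :=
  ⟨Matrix.of fun x y =>
      if x = y then ((Real.sqrt (1 - max 0 (min 1 a)) : ℝ) : ℂ)
      else if x then ((Real.sqrt (max 0 (min 1 a)) : ℝ) : ℂ)
      else -((Real.sqrt (max 0 (min 1 a)) : ℝ) : ℂ), by
    have h0 : (0 : ℝ) ≤ max 0 (min 1 a) := le_max_left _ _
    have h1 : (0 : ℝ) ≤ 1 - max 0 (min 1 a) := by
      have : max 0 (min 1 a) ≤ 1 := max_le zero_le_one (min_le_left _ _)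
      linarith
    have e0 := Real.mul_self_sqrt h0
    have e1 := Real.mul_self_sqrt h1
    generalize Real.sqrt (max 0 (min 1 a)) = s at *
    generalize Real.sqrt (1 - max 0 (min 1 a)) = c at *
    have e : (c : ℂ) * c + s * s = 1 := by
      rw [← Complex.ofReal_mul, ← Complex.ofReal_mul, ← Complex.ofReal_add, e0, e1]
      simp
    rw [Matrix.mem_unitaryGroup_iff]
    ext x y
    cases x <;> cases y <;>
      simp [Matrix.mul_apply, Matrix.star_apply] <;>
      first
        | linear_combination e
        | ring⟩

/-- The quantum Fourier transform `|k⟩ ↦ n^{-1/2} ∑ⱼ exp(2 π i j k / n) |j⟩`. -/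
def qft (n : ℕ) [NeZero n] : Matrix.unitaryGroup (Fin n) ℂ :=
  ⟨Matrix.of fun j k =>
      Complex.exp (2 * Real.pi * Complex.I * (j : ℕ) * (k : ℕ) / n) / (Real.sqrt n : ℝ), by
    have hn : (n : ℂ) ≠ 0 := Nat.cast_ne_zero.mpr (NeZero.ne n)
    have hs : ((Real.sqrt n : ℝ) : ℂ) * ((Real.sqrt n : ℝ) : ℂ) = n := by
      rw [← Complex.ofReal_mul, Real.mul_self_sqrt (Nat.cast_nonneg n)]
      simp
    have hprim := Complex.isPrimitiveRoot_exp n (NeZero.ne n)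
    rw [Matrix.mem_unitaryGroup_iff]
    ext j k
    simp only [Matrix.mul_apply, Matrix.star_apply, Matrix.of_apply]
    have hterm : ∀ l : Fin n,
        Complex.exp (2 * Real.pi * Complex.I * (j : ℕ) * (l : ℕ) / n) / (Real.sqrt n : ℝ) *
          star (Complex.exp (2 * Real.pi * Complex.I * (k : ℕ) * (l : ℕ) / n) /
            (Real.sqrt n : ℝ)) =
        (Complex.exp (2 * Real.pi * Complex.I / n) ^ (j : ℕ) /
          Complex.exp (2 * Real.pi * Complex.I / n) ^ (k : ℕ)) ^ (l : ℕ) / n := by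
      intro l
      have e1 : star (Complex.exp (2 * Real.pi * Complex.I * (k : ℕ) * (l : ℕ) / n) /
          (Real.sqrt n : ℝ)) =
          Complex.exp (-(2 * Real.pi * Complex.I * (k : ℕ) * (l : ℕ) / n)) /
          (Real.sqrt n : ℝ) := by
        rw [← starRingEnd_apply, map_div₀, ← Complex.exp_conj]
        have h2 : (starRingEnd ℂ) (2 * Real.pi * Complex.I * (k : ℕ) * (l : ℕ) / n) =
            -(2 * Real.pi * Complex.I * (k : ℕ) * (l : ℕ) / n) := by
          have h3 : (starRingEnd ℂ) 2 = 2 := map_ofNat _ 2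
          simp only [map_div₀, map_mul, h3, Complex.conj_ofReal, Complex.conj_I,
            Complex.conj_natCast]
          ring
        rw [h2, Complex.conj_ofReal]
      rw [e1, div_mul_div_comm, hs, ← Complex.exp_add, ← Complex.exp_nat_mul,
        ← Complex.exp_nat_mul, ← Complex.exp_sub, ← Complex.exp_nat_mul]
      congr 2
      ring
    rw [Finset.sum_congr rfl fun l _ => hterm l, ← Finset.sum_div,
      Fin.sum_univ_eq_sum_range (fun l => (Complex.exp (2 * Real.pi * Complex.I / n) ^ (j : ℕ) /
          Complex.exp (2 * Real.pi * Complex.I / n) ^ (k : ℕ)) ^ l) n]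
    set ζ := Complex.exp (2 * Real.pi * Complex.I / n) with hζ
    have hζ0 : ζ ≠ 0 := Complex.exp_ne_zero _
    by_cases hjk : j = k
    · subst hjk
      simp [hζ0, hn]
    · have hne : ζ ^ (j : ℕ) / ζ ^ (k : ℕ) ≠ 1 := by
        intro h
        rw [div_eq_one_iff_eq (pow_ne_zero _ hζ0)] at h
        exact hjk (Fin.ext (hprim.pow_inj j.2 k.2 h))
      have hpow : (ζ ^ (j : ℕ) / ζ ^ (k : ℕ)) ^ n = 1 := by
        rw [div_pow, ← pow_mul, ← pow_mul, mul_comm, mul_comm (k : ℕ), pow_mul, pow_mul,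
          hprim.pow_eq_one]
        simp
      rw [geom_sum_eq hne, hpow]
      simp [Matrix.one_apply_ne hjk]⟩

end QGate

/-! ### Quantum algorithms as circuits followed by a measurement -/

/-- A quantum algorithm with classical input in `I` and output in `α`, all measurements deferred
to the end: on input `i` the circuit `U i` is applied to the basis state `start` of a finite
register, the register is measured in the computational basis, and the outcome `w` is read as
`read w`. -/
structure QAlg (I α : Type) where
  W : Type
  fintypeW : Fintype W
  decEqW : DecidableEq W
  start : W
  U : I → Matrix.unitaryGroup W ℂ
  read : W → α

attribute [instance] QAlg.fintypeW QAlg.decEqW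

namespace QAlg

variable {I J α β : Type}

/-- The probability distribution of the output on input `i`. -/
def run (A : QAlg I α) (i : I) : PMF α :=
  (PMF.ofFintype
    (fun w => ENNReal.ofReal (‖(A.U i : Matrix A.W A.W ℂ) w A.start‖ ^ 2)) (by
      have h := congrFun (congrFun (Matrix.mem_unitaryGroup_iff'.mp (A.U i).2) A.start) A.start
      simp only [Matrix.mul_apply, Matrix.star_apply, Matrix.one_apply_eq] at h
      rw [← ENNReal.ofReal_sum_of_nonneg fun _ _ => by positivity, ← ENNReal.ofReal_one]
      congr 1
      have h2 : ((∑ w, ‖(A.U i : Matrix A.W A.W ℂ) w A.start‖ ^ 2 : ℝ) : ℂ) = 1 := by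
        rw [← h]
        push_cast
        refine Finset.sum_congr rfl fun w _ => ?_
        rw [← starRingEnd_apply, Complex.conj_mul']
      exact_mod_cast h2)).map A.read

/-- Classical post-processing of the measurement outcome. -/
def map (f : α → β) (A : QAlg I α) : QAlg I β where
  W := A.W
  fintypeW := A.fintypeW
  decEqW := A.decEqW
  start := A.start
  U := A.U
  read := f ∘ A.read

/-- Classical pre-processing of the input. -/
def comap (f : J → I) (A : QAlg I α) : QAlg J α where
  W := A.W
  fintypeW := A.fintypeW
  decEqW := A.decEqW
  start := A.start
  U := A.U ∘ f
  read := A.read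

/-- The uniform superposition of `|0⟩, …, |N-1⟩`. -/
def unif (I : Type) (N : ℕ) [NeZero N] : QAlg I (Fin N) where
  W := Fin N
  fintypeW := inferInstance
  decEqW := inferInstance
  start := 0
  U := fun _ => QGate.qft N
  read := id

/-- Run `A`, then run `B` on a fresh register, controlled by the (unmeasured) output of `A`;
both outputs are returned. If `A` is a superposition of indices, this calls `B` in
superposition. -/
def andThen (A : QAlg I α) (B : QAlg (I × α) β) : QAlg I (α × β) where
  W := A.W × B.W
  fintypeW := inferInstance
  decEqW := inferInstance
  start := (A.start, B.start)
  U := fun i => QGate.ctrl (fun w => B.U (i, A.read w)) * QGate.tensor (A.U i) 1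
  read := fun w => (A.read w.1, B.read w.2)

/-- Run the algorithms `A k` independently, on separate registers. -/
def par {κ : Type} [Fintype κ] [DecidableEq κ] {γ : κ → Type} (A : ∀ k, QAlg I (γ k)) :
    QAlg I (∀ k, γ k) where
  W := ∀ k, (A k).W
  fintypeW := inferInstance
  decEqW := inferInstance
  start := fun k => (A k).start
  U := fun i =>
    ⟨Matrix.of fun w w' => ∏ k, ((A k).U i : Matrix (A k).W (A k).W ℂ) (w k) (w' k), by
      rw [Matrix.mem_unitaryGroup_iff]
      ext w w'
      simp only [Matrix.mul_apply, Matrix.star_apply, Matrix.of_apply, star_prod,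
        ← Finset.prod_mul_distrib]
      rw [← Fintype.prod_sum fun k v => ((A k).U i : Matrix (A k).W (A k).W ℂ) (w k) v *
        star (((A k).U i : Matrix (A k).W (A k).W ℂ) (w' k) v)]
      have h : ∀ k, (∑ v, ((A k).U i : Matrix (A k).W (A k).W ℂ) (w k) v *
          star (((A k).U i : Matrix (A k).W (A k).W ℂ) (w' k) v)) =
          (1 : Matrix (A k).W (A k).W ℂ) (w k) (w' k) := by
        intro k
        have h := congrFun (congrFun (Matrix.mem_unitaryGroup_iff.mp ((A k).U i).2) (w k)) (w' k)
        simpa only [Matrix.mul_apply, Matrix.star_apply] using h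
      rw [Finset.prod_congr rfl fun k _ => h k]
      by_cases hw : w = w'
      · subst hw
        simp
      · rw [Matrix.one_apply_ne hw]
        obtain ⟨k, hk⟩ := Function.ne_iff.mp hw
        exact Finset.prod_eq_zero (Finset.mem_univ k) (Matrix.one_apply_ne hk)⟩
  read := fun w k => (A k).read (w k)

/-- The Grover iterate `Q = -A S₀ A⁻¹ S_χ` of the algorithm `A` for the good outputs `χ`. -/
def grover (A : QAlg I α) (χ : α → Bool) (i : I) : Matrix.unitaryGroup A.W ℂ :=
  -(A.U i * QGate.flip (fun w => decide (w = A.start)) * (A.U i)⁻¹ *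
    QGate.flip (fun w => χ (A.read w)))

/-- One round of amplitude amplification: `Q A |start⟩`. -/
def amplify (A : QAlg I α) (χ : α → Bool) : QAlg I α where
  W := A.W
  fintypeW := A.fintypeW
  decEqW := A.decEqW
  start := A.start
  U := fun i => A.grover χ i * A.U i
  read := A.read

/-- Amplitude estimation with `M` points: the estimate, `sin² (π y / M)`, of the probability that
`A` has an output in `χ`, where `y` is the outcome of phase estimation for `Q`, i.e. of measuring
the first register of `(F_M⁻¹ ⊗ 1) (∑_y |y⟩⟨y| ⊗ Q^y) (F_M ⊗ A) |0⟩|start⟩`. -/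
def ampEst (A : QAlg I α) (χ : α → Bool) (M : ℕ) [NeZero M] : QAlg I ℝ where
  W := Fin M × A.W
  fintypeW := inferInstance
  decEqW := inferInstance
  start := (0, A.start)
  U := fun i => QGate.tensor (QGate.qft M)⁻¹ 1 *
    QGate.ctrl (fun y : Fin M => A.grover χ i ^ (y : ℕ)) * QGate.tensor (QGate.qft M) (A.U i)
  read := fun w => Real.sin (Real.pi * ((w.1 : ℕ) : ℝ) / M) ^ 2

/-! ### Quantum estimation of a mean of cosines -/

/-- Median of an odd number of reals. -/
def median {r : ℕ} (f : Fin (2 * r + 1) → ℝ) : ℝ :=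
  f (Tuple.sort f ⟨r, by omega⟩)

/-- The state `D^{-1/2} ∑ⱼ |j⟩ (√a_j |1⟩ + √(1 - a_j) |0⟩)`, where the rotation is omitted if
`a_j < 0`. (Registers that hold data determined by `j` are not written.) -/
def rotated {D : ℕ} [NeZero D] (a : I → Fin D → ℝ) : QAlg I (Fin D × Bool) :=
  (unif I D).andThen
    { W := Bool
      fintypeW := inferInstance
      decEqW := inferInstance
      start := false
      U := fun x => QGate.rot (a x.1 x.2)
      read := id }

/-- Quantum estimation, up to `ε` and with failure probability `δ`, of
`D⁻¹ ∑ⱼ cos (2 π ⟨w_j, v⟩ / q)`: the contributions of the positive and of the negative cosines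
are estimated by amplitude estimation and subtracted; the median of `O(log (1/δ))` runs is
returned. -/
def meanCos {D : ℕ} [NeZero D] {ι : Type} [Fintype ι] (q : ℝ)
    (w : I → Fin D → ι → ℝ) (v : I → ι → ℝ) (ε δ : ℝ) : QAlg I ℝ :=
  let γ : I → Fin D → ℝ := fun i j => Real.cos (2 * Real.pi * (w i j ⬝ᵥ v i) / q)
  let est : Bool → QAlg I ℝ := fun pos =>
    (rotated (if pos then γ else -γ)).ampEst Prod.snd (⌈10000 / ε⌉₊ + 1)
  (par fun _ : Fin (2 * ⌈Real.log (1 / δ)⌉₊ + 1) =>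
    (par est).map fun e => e true - e false).map median

/-! ### Quantum search with a bounded-error oracle -/

/-- The majority answer of `2 s + 1` independent runs. -/
def majority (s : ℕ) (B : QAlg I Bool) : QAlg I Bool :=
  (par fun _ : Fin (2 * s + 1) => B).map fun o =>
    decide (s < (Finset.univ.filter fun k => o k = true).card)

/-- Stages of quantum search among `N` bounded-error algorithms `B (i, ·)`. Stage `0` evaluates
`B` in uniform superposition; every further stage does one round of amplitude amplification of
the flag, and then keeps the flag only if a fresh evaluation of `B` confirms it. Evaluations of
`B` are majority votes, whose length grows with the stage and with the confidence parameter
`t`. -/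
def searchStage {N : ℕ} [NeZero N] (t : ℕ) (B : QAlg (I × Fin N) Bool) :
    ℕ → QAlg I (Fin N × Bool)
  | 0 => (unif I N).andThen (majority t B)
  | k + 1 =>
    (((searchStage t B k).amplify Prod.snd).andThen
      ((majority (t + (k + 1)) B).comap fun x : I × (Fin N × Bool) => (x.1, x.2.1))).map
        fun o => (o.1.1, o.1.2 && o.2)

/-- Quantum search among `N` bounded-error algorithms, with `O(√N)` evaluations for fixed `t`:
each of the stages `0, …, ⌈log₉ N⌉` is run 40 times, and the first flagged index is returned, or
`none` if there is none. -/
def search {N : ℕ} [NeZero N] (t : ℕ) (B : QAlg (I × Fin N) Bool) : QAlg I (Option (Fin N)) :=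
  (par fun k : Fin (40 * (Nat.clog 9 N + 1)) => searchStage t B ((k : ℕ) / 40)).map fun o =>
    ((List.ofFn o).find? Prod.snd).map Prod.fst

/-! ### Quantum guessing -/

/-- Restriction of a family of algorithms to its first `min n N` members. -/
def initial {N : ℕ} (B : QAlg (Fin N) Bool) (n : ℕ) : QAlg (Unit × Fin (min n N)) Bool :=
  B.comap fun x => Fin.castLE (Nat.min_le_right n N) x.2

/-- The loop of quantum guessing: for each `k` of the list, search among the first `2 ^ k` guesses
and stop if one is found. -/
def guessLoop {N : ℕ} [NeZero N] (B : QAlg (Fin N) Bool) : List ℕ → PMF (Option (Fin N))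
  | [] => PMF.pure none
  | k :: ks =>
    haveI : NeZero (min (2 ^ k) N) :=
      ⟨(Nat.lt_min.mpr ⟨Nat.two_pow_pos k, Nat.pos_of_neZero N⟩).ne'⟩
    ((search (10 + k) (initial B (2 ^ k))).run ()).bind fun r =>
      match r with
      | some i => PMF.pure (some (Fin.castLE (Nat.min_le_right _ _) i))
      | none => guessLoop B ks

/-- Quantum guessing: search among the first `1, 2, 4, …` guesses, until all `N` are covered. -/
def guess {N : ℕ} [NeZero N] (B : QAlg (Fin N) Bool) : PMF (Option (Fin N)) :=
  guessLoop B (List.range (Nat.clog 2 N + 1))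

end QAlg

/-! ### The dual attack -/

namespace DualAttack

variable {m kenum kfft klat p q D : ℕ}

/-- Standard deviation of a distribution on `ZMod q`, through the lift centered at `0`. -/
def stdDev [NeZero q] (χ : PMF (ZMod q)) : ℝ :=
  Real.sqrt (∑ a, (χ a).toReal * (a.valMinAbs : ℝ) ^ 2 -
    (∑ a, (χ a).toReal * (a.valMinAbs : ℝ)) ^ 2)

/-- The blocks of `A = [A_enum A_fft A_lat]`. -/
def Aenum (A : Matrix (Fin m) (Fin (kenum + kfft + klat)) (ZMod q)) :
    Matrix (Fin m) (Fin kenum) (ZMod q) :=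
  A.submatrix id fun j => Fin.castAdd klat (Fin.castAdd kfft j)

def Afft (A : Matrix (Fin m) (Fin (kenum + kfft + klat)) (ZMod q)) :
    Matrix (Fin m) (Fin kfft) (ZMod q) :=
  A.submatrix id fun j => Fin.castAdd klat (Fin.natAdd kenum j)

def Alat (A : Matrix (Fin m) (Fin (kenum + kfft + klat)) (ZMod q)) :
    Matrix (Fin m) (Fin klat) (ZMod q) :=
  A.submatrix id fun j => Fin.natAdd (kenum + kfft) j

/-- The matrix `[[α I, 0], [A_latᵀ, q I]]`. -/
def basisMatrix (α : ℝ) (A : Matrix (Fin m) (Fin (kenum + kfft + klat)) (ZMod q)) :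
    Matrix (Fin m ⊕ Fin klat) (Fin m ⊕ Fin klat) ℝ :=
  Matrix.fromBlocks (α • 1) 0 ((Alat A)ᵀ.map fun a => (a.valMinAbs : ℝ)) ((q : ℝ) • 1)

/-- A vector `(α x, y_lat)`, with `x` and `y_lat` integral, of the lattice generated by the columns
of `basisMatrix α A`. -/
structure DualVector (α : ℝ) (A : Matrix (Fin m) (Fin (kenum + kfft + klat)) (ZMod q)) where
  x : Fin m → ℤ
  ylat : Fin klat → ℤ
  mem : (Sum.elim (fun i => α * (x i : ℝ)) fun k => (ylat k : ℝ)) ∈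
    Submodule.span ℤ (Set.range (basisMatrix α A)ᵀ)

/-- `x ᵀ M` modulo `q`, lifted to the centered representatives. -/
def dualRow {k : ℕ} (x : Fin m → ℤ) (M : Matrix (Fin m) (Fin k) (ZMod q)) (j : Fin k) : ℤ :=
  (((fun i => (x i : ZMod q)) ᵥ* M) j).valMinAbs

/-- `x ᵀ b` modulo `q`, lifted to the centered representative. -/
def dualRhs (x : Fin m → ℤ) (b : Fin m → ZMod q) : ℤ :=
  ((fun i => (x i : ZMod q)) ⬝ᵥ b).valMinAbs

/-- `c_{q'}` for `q' = q / gcd(p, q)`: it is `0` if `q'` is odd and `1 / (2 q')` if it is even. -/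
def cShift (p q : ℕ) : ℝ :=
  if Odd (q / Nat.gcd p q) then 0 else 1 / (2 * ((q / Nat.gcd p q : ℕ) : ℝ))

/-- The normalisation factor `ψ`. -/
def psi (q : ℕ) (sfft : Fin kfft → ZMod p) : ℂ :=
  Complex.exp (2 * Real.pi * Complex.I * (cShift p q : ℝ) / p *
    ((∑ t, (sfft t).valMinAbs : ℤ) : ℂ))

/-- The score `F_L(s_enum, s_fft)`. -/
def score {α : ℝ} {A : Matrix (Fin m) (Fin (kenum + kfft + klat)) (ZMod q)}
    (b : Fin m → ZMod q) (L : Fin D → DualVector α A)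
    (senum : Fin kenum → ZMod q) (sfft : Fin kfft → ZMod p) : ℝ :=
  (1 / psi q sfft * ∑ j, Complex.exp
    ((((∑ t, (round ((p : ℝ) / q * dualRow (L j).x (Afft A) t) : ℝ) * (sfft t).valMinAbs)
      + (p : ℝ) / q * ∑ t, (dualRow (L j).x (Aenum A) t : ℝ) * (senum t).valMinAbs
      - (p : ℝ) / q * dualRhs (L j).x b : ℝ) : ℂ) * (2 * Complex.I * Real.pi / p))).re

/-- The set `S_x^L` of guesses `s_enum` for which some score exceeds `x`. -/
def goodGuesses (p : ℕ) {α : ℝ} {A : Matrix (Fin m) (Fin (kenum + kfft + klat)) (ZMod q)}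
    (b : Fin m → ZMod q) (L : Fin D → DualVector α A) (x : ℝ) : Set (Fin kenum → ZMod q) :=
  {senum | ∃ sfft : Fin kfft → ZMod p, x < score b L senum sfft}

/-- A phase `θ` with `ψ(s_fft) = exp(- 2 π i θ / p)`. -/
def theta (q : ℕ) (sfft : Fin kfft → ZMod p) : ℝ :=
  -(cShift p q * ((∑ t, (sfft t).valMinAbs : ℤ) : ℝ))

/-- The vector returned by the memory oracle at index `j`:
`((p/q) y_enum, round ((p/q) y_fft), θ - (p/q) xᵀ b)`. -/
def oracleVector {α : ℝ} {A : Matrix (Fin m) (Fin (kenum + kfft + klat)) (ZMod q)}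
    (b : Fin m → ZMod q) (L : Fin D → DualVector α A) (sfft : Fin kfft → ZMod p) (j : Fin D) :
    Fin kenum ⊕ Fin kfft ⊕ Unit → ℝ :=
  Sum.elim (fun t => (p : ℝ) / q * dualRow (L j).x (Aenum A) t)
    (Sum.elim (fun t => (round ((p : ℝ) / q * dualRow (L j).x (Afft A) t) : ℝ))
      fun _ => theta q sfft - (p : ℝ) / q * dualRhs (L j).x b)

/-- The vector `(s_enum, s_fft, 1)`. -/
def guessVector (senum : Fin kenum → ZMod q) (sfft : Fin kfft → ZMod p) :
    Fin kenum ⊕ Fin kfft ⊕ Unit → ℝ :=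
  Sum.elim (fun t => ((senum t).valMinAbs : ℝ))
    (Sum.elim (fun t => ((sfft t).valMinAbs : ℝ)) fun _ => 1)

/-- An enumeration of the guesses `s_fft`. -/
def fftEnum (p kfft : ℕ) [NeZero p] : Fin (p ^ kfft) ≃ (Fin kfft → ZMod p) :=
  Fintype.equivOfCardEq (by simp [ZMod.card])

/-- The inner oracle: is the estimate of `F_L(s_enum, s_fft) / D`, with precision
`(C / D) η` and failure probability `1/10`, above `(1 + η) C / D`? -/
def fftOracle [NeZero p] [NeZero D] {α : ℝ}
    {A : Matrix (Fin m) (Fin (kenum + kfft + klat)) (ZMod q)}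
    (b : Fin m → ZMod q) (L : Fin D → DualVector α A) (C η : ℝ) :
    QAlg ((Fin kenum → ZMod q) × (Fin kfft → ZMod p)) Bool :=
  (QAlg.meanCos (p : ℝ) (fun s => oracleVector b L s.2) (fun s => guessVector s.1 s.2)
    (C / D * η) (1 / 10)).map fun e => decide ((1 + η) * (C / D) < e)

/-- The outer oracle: does quantum search find an `s_fft` accepted by the inner oracle? -/
def enumOracle (p : ℕ) [NeZero p] [NeZero D] {α : ℝ}
    {A : Matrix (Fin m) (Fin (kenum + kfft + klat)) (ZMod q)}
    (b : Fin m → ZMod q) (L : Fin D → DualVector α A) (C η : ℝ) :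
    QAlg (Fin kenum → ZMod q) Bool :=
  (QAlg.search 10 ((fftOracle b L C η).comap fun s => (s.1, fftEnum p kfft s.2))).map
    Option.isSome

/-- The output distribution of the quantum dual attack, once the list `L` has been sampled;
`ord` lists the guesses `s_enum` in the order in which they are tried. -/
def attack (p : ℕ) [NeZero p] [NeZero q] [NeZero D] {α : ℝ}
    {A : Matrix (Fin m) (Fin (kenum + kfft + klat)) (ZMod q)}
    (b : Fin m → ZMod q) (L : Fin D → DualVector α A) (C η : ℝ)
    (ord : Fin (q ^ kenum) ≃ (Fin kenum → ZMod q)) : PMF (Option (Fin kenum → ZMod q)) :=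
  (QAlg.guess ((enumOracle p b L C η).comap ord)).map (Option.map ord)

end DualAttack

end

/-! A register that only controls later gates causes no interference. Sequential composition
therefore obeys the law of total expectation (`expect_andThen`), and parallel runs are independent
(`expect_par_prod`). Interference enters only through Grover iterates. These keep the state in the
plane spanned by its good and bad parts: if the good part has weight `P = sin² θ`, then after `k`
iterations the two parts are scaled by `sin ((2k+1)θ) / sin θ` and `cos ((2k+1)θ) / cos θ`. Two
consequences are used. Phase estimation sees an equal mixture of the phases `θ` and `-θ`, so Fejér
tails bound the error of amplitude estimation (`ampEst_error_le`). One round of amplification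
multiplies good weights by `(3 - 4P)²` (`expect_amplify`).

The inner oracle thresholds an estimate midway between `C / D` and `(1 + 2η) C / D`. It errs with
probability at most `1/10` on scores that are at most `C` or above `(1 + 2η) C`. Nothing is known in
between, so the search bounds may only speak of surely bad indices and of one surely good index.

In a search, a stage amplifies any flagged weight at most ninefold, while fresh majority votes
shrink the bad weight much faster (`flagWeight_bad_le`). The weight of a good index starts near
`1/N` and grows almost ninefold per stage, unless the total flagged weight `P` is already noticeable
(`le_flagWeight_of_good`). Either way the flag probabilities of the `⌈log₉ N⌉ + 1` stages sum to at
least `1/4`, and 40 repetitions miss with probability at most `e⁻¹⁰`.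

The search bounds are applied twice. They make the outer oracle reliable outside `S_C` and inside
`S_{(1+2η)C}`, and they then control each round of guessing. The confidence grows with the round, so
the probabilities of returning a bad guess form a convergent geometric series. The round that covers
all guesses rarely misses a good one. -/

namespace QAlg

/-! ### Outcome statistics of composed circuits -/

variable {I J α β : Type}

/-- The amplitude of the basis state `w` before the measurement. -/
def amp (A : QAlg I α) (i : I) (w : A.W) : ℂ := (A.U i : Matrix A.W A.W ℂ) w A.start

/-- The expectation of `f` of the output. -/
noncomputable def expect (A : QAlg I α) (i : I) (f : α → ℝ) : ℝ :=
  ∑ w, ‖A.amp i w‖ ^ 2 * f (A.read w)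

theorem sum_norm_sq_amp (A : QAlg I α) (i : I) : ∑ w, ‖A.amp i w‖ ^ 2 = 1 := by
  have h := congrFun (congrFun (Matrix.mem_unitaryGroup_iff'.mp (A.U i).2) A.start) A.start
  simp only [Matrix.mul_apply, Matrix.star_apply, Matrix.one_apply_eq] at h
  have h2 : ((∑ w, ‖A.amp i w‖ ^ 2 : ℝ) : ℂ) = 1 := by
    rw [← h]
    push_cast
    refine Finset.sum_congr rfl fun w _ => ?_
    rw [← starRingEnd_apply, Complex.conj_mul', amp]
  exact_mod_cast h2

theorem expect_const (A : QAlg I α) (i : I) (c : ℝ) : A.expect i (fun _ => c) = c := by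
  rw [expect, ← Finset.sum_mul, sum_norm_sq_amp, one_mul]

theorem expect_mono (A : QAlg I α) (i : I) {f g : α → ℝ} (h : ∀ a, f a ≤ g a) :
    A.expect i f ≤ A.expect i g :=
  Finset.sum_le_sum fun w _ => mul_le_mul_of_nonneg_left (h _) (by positivity)

theorem expect_nonneg (A : QAlg I α) (i : I) {f : α → ℝ} (h : ∀ a, 0 ≤ f a) :
    0 ≤ A.expect i f :=
  Finset.sum_nonneg fun w _ => mul_nonneg (by positivity) (h _)

theorem expect_le_one (A : QAlg I α) (i : I) {f : α → ℝ} (h : ∀ a, f a ≤ 1) :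
    A.expect i f ≤ 1 :=
  (A.expect_mono i h).trans_eq (A.expect_const i 1)

theorem expect_sum {κ : Type*} (s : Finset κ) (A : QAlg I α) (i : I) (f : κ → α → ℝ) :
    A.expect i (fun a => ∑ k ∈ s, f k a) = ∑ k ∈ s, A.expect i (f k) := by
  simp only [expect, Finset.mul_sum]
  exact Finset.sum_comm

theorem expect_const_mul (A : QAlg I α) (i : I) (c : ℝ) (f : α → ℝ) :
    A.expect i (fun a => c * f a) = c * A.expect i f := by
  rw [expect, expect, Finset.mul_sum]
  exact Finset.sum_congr rfl fun w _ => by ring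

theorem expect_one_sub (A : QAlg I α) (i : I) (f : α → ℝ) :
    A.expect i (fun a => 1 - f a) = 1 - A.expect i f := by
  simp only [expect, mul_sub, Finset.sum_sub_distrib, mul_one, sum_norm_sq_amp]

theorem expect_map (A : QAlg I α) (g : α → β) (i : I) (f : β → ℝ) :
    (A.map g).expect i f = A.expect i (f ∘ g) := rfl

theorem expect_comap (A : QAlg I α) (g : J → I) (j : J) (f : α → ℝ) :
    (A.comap g).expect j f = A.expect (g j) f := rfl

open Classical in
theorem run_toOuterMeasure (A : QAlg I α) (i : I) (S : Set α) :
    (A.run i).toOuterMeasure S =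
      ENNReal.ofReal (A.expect i fun a => if a ∈ S then 1 else 0) := by
  rw [run, PMF.toOuterMeasure_map_apply, PMF.toOuterMeasure_ofFintype_apply, expect,
    ENNReal.ofReal_sum_of_nonneg fun w _ => by positivity, tsum_fintype]
  refine Finset.sum_congr rfl fun w _ => ?_
  by_cases h : A.read w ∈ S <;> simp [Set.indicator, h, amp]

/-- The first register is only a control for the second gate, so exactly one path leads to each
basis state and the amplitudes multiply. -/
theorem amp_andThen (A : QAlg I α) (B : QAlg (I × α) β) (i : I) (w : A.W) (v : B.W) :
    (A.andThen B).amp i (w, v) = A.amp i w * B.amp (i, A.read w) v := by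
  simp only [amp, andThen, QGate.ctrl, QGate.tensor, Matrix.UnitaryGroup.mul_val,
    Matrix.mul_apply, Fintype.sum_prod_type, Matrix.of_apply, Matrix.kronecker,
    Matrix.kroneckerMap_apply, Matrix.UnitaryGroup.one_val]
  rw [Finset.sum_eq_single w, Finset.sum_eq_single B.start]
  · simp [mul_comm]
  · intro u _ hu
    simp [Matrix.one_apply_ne hu]
  · simp
  · intro u _ hu
    simp [Ne.symm hu]
  · simp

theorem expect_andThen (A : QAlg I α) (B : QAlg (I × α) β) (i : I) (f : α × β → ℝ) :
    (A.andThen B).expect i f = A.expect i fun a => B.expect (i, a) fun b => f (a, b) := by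
  rw [expect]
  refine (Fintype.sum_prod_type _).trans ?_
  rw [expect]
  refine Finset.sum_congr rfl fun w _ => ?_
  rw [expect, Finset.mul_sum]
  refine Finset.sum_congr rfl fun v _ => ?_
  rw [amp_andThen, norm_mul]
  change _ * f (A.read w, B.read v) = _
  ring

theorem expect_par_prod {κ : Type} [Fintype κ] [DecidableEq κ] {γ : κ → Type}
    (A : ∀ k, QAlg I (γ k)) (i : I) (f : ∀ k, γ k → ℝ) :
    (par A).expect i (fun o => ∏ k, f k (o k)) = ∏ k, (A k).expect i (f k) := by
  simp only [expect]
  rw [Fintype.prod_sum]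
  refine Finset.sum_congr rfl fun w _ => ?_
  have h : (par A).amp i w = ∏ k, (A k).amp i (w k) := rfl
  rw [h, norm_prod, ← Finset.prod_pow, ← Finset.prod_mul_distrib]
  rfl

theorem expect_par_single {κ : Type} [Fintype κ] [DecidableEq κ] {γ : κ → Type}
    (A : ∀ k, QAlg I (γ k)) (i : I) (k : κ) (f : γ k → ℝ) :
    (par A).expect i (fun o => f (o k)) = (A k).expect i f := by
  classical
  -- The marginal is the product formula with the constant `1` in every other factor.
  have h := expect_par_prod A i (fun l => if h : l = k then h ▸ f else fun _ => 1)
  rw [Finset.prod_eq_single k] at h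
  · simp only [dite_true] at h
    rw [← h]
    congr 1
    funext o
    rw [Finset.prod_eq_single k]
    · simp
    · intro l _ hl
      simp [hl]
    · simp
  · intro l _ hl
    simp [hl, expect_const]
  · simp

theorem expect_unif (I : Type) (N : ℕ) [NeZero N] (i : I) (f : Fin N → ℝ) :
    (unif I N).expect i f = (∑ j, f j) / N := by
  rw [expect, Finset.sum_div]
  refine Finset.sum_congr rfl fun j _ => ?_
  have h : (unif I N).amp i j = 1 / (Real.sqrt N : ℝ) := by
    change Complex.exp (2 * Real.pi * Complex.I * (Fin.val (n := N) j) * ((0 : Fin N) : ℕ) / N) / _ = _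
    simp
  rw [h]
  have hN : (0 : ℝ) ≤ N := Nat.cast_nonneg N
  simp only [norm_div, norm_one, Complex.norm_real, Real.norm_eq_abs, div_pow, sq_abs,
    Real.sq_sqrt hN, one_pow]
  change 1 / (N : ℝ) * f j = f j / N
  ring

/-- Omitting the rotation for negative `a` leaves the mean of the positive parts; applied to `γ` and
`-γ`, this recovers the mean of `γ` as a difference. -/
theorem expect_rotated {D : ℕ} [NeZero D] (a : I → Fin D → ℝ) (ha : ∀ i j, a i j ≤ 1) (i : I) :
    (rotated a).expect i (fun o => if o.2 = true then 1 else 0) = (∑ j, max 0 (a i j)) / D := by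
  rw [rotated, expect_andThen, expect_unif]
  congr 1
  refine Finset.sum_congr rfl fun j _ => ?_
  rw [expect]
  refine (Fintype.sum_bool _).trans ?_
  simp [amp, QGate.rot, Real.sq_sqrt, ha i j]

/-- The probability that the output satisfies `χ`. -/
noncomputable def prob (A : QAlg I α) (χ : α → Bool) (i : I) : ℝ :=
  A.expect i fun a => if χ a = true then 1 else 0

theorem prob_nonneg (A : QAlg I α) (χ : α → Bool) (i : I) : 0 ≤ A.prob χ i :=
  A.expect_nonneg i fun a => by split_ifs <;> norm_num

theorem prob_le_one (A : QAlg I α) (χ : α → Bool) (i : I) : A.prob χ i ≤ 1 :=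
  A.expect_le_one i fun a => by split_ifs <;> norm_num

theorem prob_not (A : QAlg I α) (χ : α → Bool) (i : I) :
    A.prob (fun a => !χ a) i = 1 - A.prob χ i := by
  rw [prob, prob, ← expect_one_sub]
  congr 1
  funext a
  cases χ a <;> simp

/-! ### The Grover iterate -/

/-- Since `S₀ = 1 - 2 |start⟩⟨start|`, conjugation by `A` turns `-S₀` into `2 |ψ⟩⟨ψ| - 1` with `ψ =
A |start⟩`, which acts on the vector with flipped good signs. -/
theorem grover_mulVec (A : QAlg I α) (χ : α → Bool) (i : I) (v : A.W → ℂ) (w : A.W) :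
    ((A.grover χ i : Matrix A.W A.W ℂ) *ᵥ v) w =
      2 * A.amp i w * ∑ u, star (A.amp i u) * (if χ (A.read u) then -v u else v u) -
        (if χ (A.read w) then -v w else v w) := by
  set v' : A.W → ℂ := fun u => if χ (A.read u) then -v u else v u with hv'
  have h1 : ((QGate.flip fun w => χ (A.read w) : Matrix.unitaryGroup A.W ℂ) :
      Matrix A.W A.W ℂ) *ᵥ v = v' := by
    funext u
    simp only [QGate.flip, Matrix.mulVec_diagonal, hv']
    split_ifs <;> simp
  have h2 : ∀ z : A.W → ℂ, ((QGate.flip fun w => decide (w = A.start) :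
      Matrix.unitaryGroup A.W ℂ) : Matrix A.W A.W ℂ) *ᵥ z =
      z - Pi.single A.start (2 * z A.start) := by
    intro z
    funext u
    simp only [QGate.flip, Matrix.mulVec_diagonal, Pi.sub_apply]
    by_cases h : u = A.start
    · subst h
      simp
      ring
    · simp [h]
  have h3 : (A.U i : Matrix A.W A.W ℂ) *ᵥ (star (A.U i : Matrix A.W A.W ℂ) *ᵥ v') = v' := by
    rw [Matrix.mulVec_mulVec, Matrix.mem_unitaryGroup_iff.mp (A.U i).2, Matrix.one_mulVec]
  have h4 : (star (A.U i : Matrix A.W A.W ℂ) *ᵥ v') A.start =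
      ∑ u, star (A.amp i u) * v' u := rfl
  rw [grover, Unitary.coe_neg, Matrix.neg_mulVec, Matrix.UnitaryGroup.mul_val,
    Matrix.UnitaryGroup.mul_val, Matrix.UnitaryGroup.mul_val, Matrix.UnitaryGroup.inv_val,
    ← Matrix.mulVec_mulVec, h1, ← Matrix.mulVec_mulVec, ← Matrix.mulVec_mulVec, h2,
    Matrix.mulVec_sub, h3, h4, Pi.neg_apply, Pi.sub_apply, Matrix.mulVec_single]
  simp only [Pi.smul_apply, Matrix.col_apply, MulOpposite.smul_eq_mul_unop, MulOpposite.unop_op]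
  change -(v' w - A.amp i w * _) = _ - v' w
  ring

/-- The coefficients of the good and of the bad part of the state after `k` Grover iterations, if
the good outputs have probability `P`. -/
noncomputable def groverCoeff (P : ℝ) : ℕ → ℝ × ℝ
  | 0 => (1, 1)
  | k + 1 =>
    let z := groverCoeff P k
    let c := 2 * (z.2 * (1 - P) - z.1 * P)
    (z.1 + c, c - z.2)

/-- Each iteration rotates by `2θ`. The multiplied form also covers `sin θ = 0` and `cos θ = 0`. -/
theorem groverCoeff_mul (θ : ℝ) (k : ℕ) :
    (groverCoeff (Real.sin θ ^ 2) k).1 * Real.sin θ = Real.sin ((2 * k + 1) * θ) ∧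
      (groverCoeff (Real.sin θ ^ 2) k).2 * Real.cos θ = Real.cos ((2 * k + 1) * θ) := by
  induction k with
  | zero => simp [groverCoeff]
  | succ k ih =>
    obtain ⟨h1, h2⟩ := ih
    have e : (2 * ((k + 1 : ℕ) : ℝ) + 1) * θ = (2 * k + 1) * θ + 2 * θ := by
      push_cast
      ring
    have hc := Real.sin_sq_add_cos_sq θ
    rw [e, Real.sin_add, Real.cos_add, ← h1, ← h2, Real.sin_two_mul, Real.cos_two_mul]
    simp only [groverCoeff]
    generalize (groverCoeff (Real.sin θ ^ 2) k).1 = x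
    generalize (groverCoeff (Real.sin θ ^ 2) k).2 = y
    generalize Real.sin θ = s at *
    generalize Real.cos θ = c at *
    have hs : s ^ 2 = 1 - c ^ 2 := by linarith
    constructor
    · linear_combination (-2 * y * s - 2 * x * s) * hs
    · linear_combination (-2 * y * c) * hs

theorem grover_pow_mulVec (A : QAlg I α) (χ : α → Bool) (i : I) (k : ℕ) (w : A.W) :
    (((A.grover χ i ^ k : Matrix.unitaryGroup A.W ℂ) : Matrix A.W A.W ℂ) *ᵥ A.amp i) w =
      ((if χ (A.read w) then (groverCoeff (A.prob χ i) k).1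
        else (groverCoeff (A.prob χ i) k).2 : ℝ) : ℂ) * A.amp i w := by
  induction k generalizing w with
  | zero => simp [groverCoeff]
  | succ k ih =>
    rw [pow_succ', Matrix.UnitaryGroup.mul_val, ← Matrix.mulVec_mulVec, grover_mulVec]
    simp only [ih]
    -- The overlap of the initial state with the sign-flipped current state: the bad part has weight
    -- `1 - P`, the good part weight `P` and a minus sign.
    have hs : ∑ u, star (A.amp i u) * (if χ (A.read u) then
        -(((if χ (A.read u) then (groverCoeff (A.prob χ i) k).1
          else (groverCoeff (A.prob χ i) k).2 : ℝ) : ℂ) * A.amp i u) else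
        ((if χ (A.read u) then (groverCoeff (A.prob χ i) k).1
          else (groverCoeff (A.prob χ i) k).2 : ℝ) : ℂ) * A.amp i u) =
        (((groverCoeff (A.prob χ i) k).2 * (1 - A.prob χ i) -
          (groverCoeff (A.prob χ i) k).1 * A.prob χ i : ℝ) : ℂ) := by
      rw [← prob_not]
      generalize (groverCoeff (A.prob χ i) k).1 = x
      generalize (groverCoeff (A.prob χ i) k).2 = y
      rw [prob, prob, expect, expect, Finset.mul_sum, Finset.mul_sum, ← Finset.sum_sub_distrib,
        Complex.ofReal_sum]
      refine Finset.sum_congr rfl fun u _ => ?_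
      have e : star (A.amp i u) * A.amp i u = ((‖A.amp i u‖ ^ 2 : ℝ) : ℂ) := by
        rw [← starRingEnd_apply, Complex.conj_mul']
        push_cast
        rfl
      cases h : χ (A.read u)
      · simp only [Bool.false_eq_true, if_false, Bool.not_false, if_true]
        rw [mul_left_comm, e]
        push_cast
        ring
      · simp only [Bool.false_eq_true, if_false, Bool.not_true, if_true]
        rw [mul_neg, mul_left_comm, e]
        push_cast
        ring
    rw [hs]
    simp only [groverCoeff]
    split_ifs <;> push_cast <;> ring

/-- All good amplitudes get the same factor `3 - 4P`, so amplification preserves their relative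
weights. -/
theorem expect_amplify (A : QAlg I α) (χ : α → Bool) (i : I) (f : α → ℝ)
    (hf : ∀ a, χ a = false → f a = 0) :
    (A.amplify χ).expect i f = (3 - 4 * A.prob χ i) ^ 2 * A.expect i f := by
  rw [expect, expect, Finset.mul_sum]
  refine Finset.sum_congr rfl fun w _ => ?_
  have h : (A.amplify χ).amp i w = ((A.grover χ i ^ 1 : Matrix.unitaryGroup A.W ℂ) :
      Matrix A.W A.W ℂ).mulVec (A.amp i) w := by
    rw [pow_one]
    rfl
  have hc : (groverCoeff (A.prob χ i) 1).1 = 3 - 4 * A.prob χ i := by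
    simp only [groverCoeff]
    ring
  change ‖(A.amplify χ).amp i w‖ ^ 2 * f (A.read w) = _
  rw [h]
  erw [grover_pow_mulVec]
  cases hw : χ (A.read w)
  · rw [hf _ hw]
    ring
  · rw [if_pos rfl, hc, norm_mul, Complex.norm_real, mul_pow, Real.norm_eq_abs, sq_abs]
    ring

end QAlg

/-! ### The tail of the Fejér kernel -/

/-- A geometric sum: its denominator has modulus `2 |sin φ|` and its numerator modulus at most `2`.
-/
theorem norm_sum_exp_mul_abs_sin_le (φ : ℝ) (M : ℕ) :
    ‖∑ k ∈ Finset.range M, Complex.exp (Complex.I * (2 * φ : ℝ)) ^ k‖ * |Real.sin φ| ≤ 1 := by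
  have h1 : ‖Complex.exp (Complex.I * (2 * φ : ℝ)) - 1‖ = 2 * |Real.sin φ| := by
    rw [Complex.norm_exp_I_mul_ofReal_sub_one, norm_mul, mul_div_cancel_left₀ _ two_ne_zero]
    simp
  have h2 := geom_sum_mul (Complex.exp (Complex.I * (2 * φ : ℝ))) M
  have h3 : ‖Complex.exp (Complex.I * (2 * φ : ℝ)) ^ M - 1‖ ≤ 2 := by
    refine (norm_sub_le _ _).trans ?_
    rw [norm_pow, mul_comm, Complex.norm_exp_ofReal_mul_I]
    norm_num
  rw [← h2, norm_mul, h1] at h3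
  linarith

/-- Jordan's inequality on the first quarter period, reflected at `1/2`. -/
theorem two_mul_min_le_abs_sin {x : ℝ} (hx : |x| ≤ 1) :
    2 * min |x| (1 - |x|) ≤ |Real.sin (Real.pi * x)| := by
  have hπ := Real.pi_pos
  have h0 := abs_nonneg x
  have key : ∀ y : ℝ, 0 ≤ y → y ≤ 1 / 2 → 2 * y ≤ Real.sin (Real.pi * y) := by
    intro y hy hy2
    have := Real.mul_le_sin (x := Real.pi * y) (by positivity) (by nlinarith)
    calc 2 * y = 2 / Real.pi * (Real.pi * y) := by field_simp
      _ ≤ _ := this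
  have e : |Real.sin (Real.pi * x)| = |Real.sin (Real.pi * |x|)| := by
    rcases abs_choice x with h | h <;> rw [h]
    rw [mul_neg, Real.sin_neg, abs_neg]
  rw [e]
  refine le_trans ?_ (le_abs_self _)
  rcases le_total |x| (1 / 2) with h | h
  · exact le_trans (by gcongr; exact min_le_left _ _) (key _ h0 h)
  · have h2 := key (1 - |x|) (by linarith) (by linarith)
    rw [show Real.pi * (1 - |x|) = Real.pi - Real.pi * |x| by ring, Real.sin_pi_sub] at h2
    refine le_trans ?_ h2
    have := min_le_right |x| (1 - |x|)
    linarith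

/-- Telescoping: `(k - 1/2)² ≥ (k - 1) k`, and `1 / ((k - 1) k)` is the difference of `1 / (k - 1)`
and `1 / k`. -/
theorem sum_range_inv_sq_tail_le {J : ℕ} (hJ : 2 ≤ J) (n : ℕ) :
    ∑ k ∈ Finset.range n, (if J ≤ k then 1 / (4 * ((k : ℝ) - 1 / 2) ^ 2) else 0) ≤
      1 / (4 * ((J : ℝ) - 1)) := by
  have hJ' : (2 : ℝ) ≤ J := by exact_mod_cast hJ
  have h : ∀ d : ℕ, ∑ k ∈ Finset.range (J + d),
      (if J ≤ k then 1 / (4 * ((k : ℝ) - 1 / 2) ^ 2) else 0) ≤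
      1 / (4 * ((J : ℝ) - 1)) - 1 / (4 * ((J : ℝ) + d - 1)) := by
    intro d
    induction d with
    | zero =>
      rw [Finset.sum_eq_zero]
      · simp
      · intro k hk
        rw [if_neg (by simpa using hk)]
    | succ d ih =>
      have hd : (0 : ℝ) ≤ d := Nat.cast_nonneg d
      rw [← add_assoc, Finset.sum_range_succ, if_pos (Nat.le_add_right J d)]
      refine (add_le_add_left ih _).trans ?_
      push_cast
      have e : 1 / (4 * ((J : ℝ) + d - 1)) - 1 / (4 * ((J : ℝ) + (d + 1) - 1)) =
          1 / (4 * (((J : ℝ) + d - 1) * (J + d))) := by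
        have h1 : (J : ℝ) + d - 1 ≠ 0 := by linarith
        have h2 : (J : ℝ) + d ≠ 0 := by linarith
        rw [show (J : ℝ) + (d + 1) - 1 = J + d by ring]
        field_simp
        ring
      have h3 : 1 / (4 * ((J : ℝ) + d - 1 / 2) ^ 2) ≤
          1 / (4 * (((J : ℝ) + d - 1) * (J + d))) := by
        refine one_div_le_one_div_of_le ?_ (by nlinarith)
        have : 0 < (J : ℝ) + d - 1 := by linarith
        positivity
      linarith
  refine (Finset.sum_le_sum_of_subset_of_nonneg (Finset.range_subset_range.mpr
    (Nat.le_add_left n J)) fun k _ _ => ?_).trans ((h n).trans ?_)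
  · split_ifs <;> positivity
  · have : 0 < (J : ℝ) + n - 1 := by
      have : (0 : ℝ) ≤ n := Nat.cast_nonneg n
      linarith
    have : 0 ≤ 1 / (4 * ((J : ℝ) + n - 1)) := by positivity
    linarith

theorem sum_Icc_inv_sq_tail_le {J : ℕ} (hJ : 2 ≤ J) (n : ℕ) :
    ∑ j ∈ Finset.Icc (-(n : ℤ)) n, (if J ≤ j.natAbs then 1 / (4 * ((j.natAbs : ℝ) - 1 / 2) ^ 2)
      else 0) ≤ 1 / (2 * ((J : ℝ) - 1)) := by
  have h0 := sum_range_inv_sq_tail_le hJ (n + 1)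
  rw [Finset.sum_Icc_of_even_eq_range (fun j => by simp)]
  have hz : ¬ J ≤ 0 := by omega
  simp only [Int.natAbs_natCast, Int.natAbs_zero, if_neg hz, sub_zero, two_nsmul]
  have hJ' : (J : ℝ) - 1 ≠ 0 := by
    have : (2 : ℝ) ≤ J := by exact_mod_cast hJ
    linarith
  refine (add_le_add h0 h0).trans_eq ?_
  field_simp
  norm_num

/-- Here `j` is the signed cyclic distance from `y` to the grid point nearest to `Mθ/π`. Modulo `π`
the angle is `π (j + r) / M`, where the rounding error satisfies `|r| ≤ 1/2`. -/
theorem abs_sin_pi_div_sub_bounds {M : ℕ} [NeZero M] (θ : ℝ) (y : ℤ) (j : ℤ)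
    (hj : j = ((y - round (M * θ / Real.pi) : ℤ) : ZMod M).valMinAbs) :
    2 * ((j.natAbs : ℝ) - 1 / 2) / M ≤ |Real.sin (Real.pi * y / M - θ)| ∧
      |Real.sin (Real.pi * y / M - θ)| ≤ Real.pi * ((j.natAbs : ℝ) + 1 / 2) / M := by
  have hπ := Real.pi_pos
  have hM : (0 : ℝ) < M := Nat.cast_pos.mpr (Nat.pos_of_neZero M)
  have hM1 : (1 : ℝ) ≤ M := by exact_mod_cast Nat.pos_of_neZero M
  set y0 := round (M * θ / Real.pi) with hy0
  set r : ℝ := y0 - M * θ / Real.pi with hr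
  have hr2 : |r| ≤ 1 / 2 := by
    rw [hr, abs_sub_comm]
    exact abs_sub_round _
  obtain ⟨l, hl⟩ : (M : ℤ) ∣ (y - y0) - j := by
    rw [← ZMod.intCast_eq_intCast_iff_dvd_sub, hj, ZMod.coe_valMinAbs]
  have hjM : (j.natAbs : ℝ) ≤ M / 2 := by
    have := ZMod.natAbs_valMinAbs_le ((y - y0 : ℤ) : ZMod M)
    rw [← hj] at this
    have h2 : 2 * j.natAbs ≤ M := by omega
    have h3 : (2 * j.natAbs : ℝ) ≤ M := by exact_mod_cast h2
    linarith
  have habs : (j.natAbs : ℝ) = |(j : ℝ)| := by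
    rw [Nat.cast_natAbs, Int.cast_abs]
  have hy : (y : ℝ) = y0 + j + M * l := by
    have : y = y0 + j + M * l := by omega
    exact_mod_cast this
  have e : Real.pi * y / M - θ = Real.pi * ((j + r) / M) + l * Real.pi := by
    rw [hy, hr]
    field_simp
    ring
  have e2 : |Real.sin (Real.pi * y / M - θ)| = |Real.sin (Real.pi * ((j + r) / M))| := by
    rw [e, Real.sin_add_int_mul_pi, abs_mul]
    simp
  have hx1 : |(j : ℝ) + r| ≤ j.natAbs + 1 / 2 := by
    rw [habs]
    exact (abs_add_le _ _).trans (by linarith)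
  have hx2 : (j.natAbs : ℝ) - 1 / 2 ≤ |(j : ℝ) + r| := by
    have := abs_sub_abs_le_abs_add (j : ℝ) r
    rw [habs]
    linarith
  have hx : |((j : ℝ) + r) / M| = |(j : ℝ) + r| / M := by rw [abs_div, abs_of_pos hM]
  rw [e2]
  constructor
  · refine le_trans ?_ (two_mul_min_le_abs_sin ?_)
    · rw [mul_div_assoc]
      gcongr
      rw [hx]
      -- The reflected branch of the minimum is where `|j| ≤ M / 2` is needed.
      refine le_min (by gcongr) ?_
      rw [div_le_iff₀ hM, sub_mul, div_mul_cancel₀ _ hM.ne']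
      linarith
    · rw [hx, div_le_one hM]
      linarith
  · refine Real.abs_sin_le_abs.trans ?_
    rw [abs_mul, hx, abs_of_pos hπ, mul_div_assoc]
    gcongr

/-- The Fourier coefficient, at `y`, of the phases `exp (i (2 k + 1) θ)`. -/
noncomputable def phaseCoeff (M : ℕ) (θ : ℝ) (y : ℕ) : ℂ :=
  ∑ k : Fin M, Complex.exp (-(2 * Real.pi * Complex.I * (k : ℕ) * y / M)) / M *
    Complex.exp (Complex.I * ((2 * (k : ℕ) + 1) * θ))

theorem norm_phaseCoeff_mul_le (M : ℕ) [NeZero M] (θ : ℝ) (y : ℕ) :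
    ‖phaseCoeff M θ y‖ * (M * |Real.sin (Real.pi * y / M - θ)|) ≤ 1 := by
  have hM : (M : ℂ) ≠ 0 := Nat.cast_ne_zero.mpr (NeZero.ne M)
  have hM' : (M : ℝ) ≠ 0 := Nat.cast_ne_zero.mpr (NeZero.ne M)
  have h := norm_sum_exp_mul_abs_sin_le (θ - Real.pi * y / M) M
  have e : phaseCoeff M θ y = Complex.exp (Complex.I * θ) / M *
      ∑ k ∈ Finset.range M, Complex.exp (Complex.I * (2 * (θ - Real.pi * y / M) : ℝ)) ^ k := by
    rw [phaseCoeff, Fin.sum_univ_eq_sum_range (fun k : ℕ =>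
      Complex.exp (-(2 * Real.pi * Complex.I * k * y / M)) / M *
      Complex.exp (Complex.I * ((2 * (k : ℕ) + 1) * θ))), Finset.mul_sum]
    refine Finset.sum_congr rfl fun k _ => ?_
    rw [← Complex.exp_nat_mul, div_mul_eq_mul_div, div_mul_eq_mul_div, ← Complex.exp_add,
      ← Complex.exp_add]
    congr 2
    push_cast
    field_simp
    ring
  have h1 : ‖Complex.exp (Complex.I * θ) / M‖ = 1 / M := by
    rw [norm_div, mul_comm, Complex.norm_exp_ofReal_mul_I, Complex.norm_natCast]
  rw [e, norm_mul, h1, ← neg_sub θ, Real.sin_neg, abs_neg]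
  refine le_trans (le_of_eq ?_) h
  field_simp

/-- An error above `ε` forces cyclic distance at least `J` from the peak. Distinct outcomes have
distinct signed distances, so the mass is bounded by a two-sided inverse-square tail. -/
theorem sum_phaseCoeff_tail_le {M J : ℕ} [NeZero M] (hJ : 2 ≤ J) (θ ε : ℝ)
    (hε : Real.pi * J ≤ M * ε) :
    ∑ y : Fin M, (if ε < |Real.sin (Real.pi * (y : ℕ) / M - θ)| then
      ‖phaseCoeff M θ y‖ ^ 2 else 0) ≤ 1 / (2 * ((J : ℝ) - 1)) := by
  have hπ := Real.pi_pos
  have hM : (0 : ℝ) < M := Nat.cast_pos.mpr (Nat.pos_of_neZero M)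
  set y0 := round (M * θ / Real.pi) with hy0
  set g : Fin M → ℤ := fun y => (((y : ℕ) - y0 : ℤ) : ZMod M).valMinAbs with hg
  have hinj : Function.Injective g := by
    intro y z hyz
    have h1 := ZMod.injective_valMinAbs hyz
    push_cast at h1
    have h2 := sub_left_injective h1
    rw [ZMod.natCast_eq_natCast_iff'] at h2
    rw [Nat.mod_eq_of_lt y.2, Nat.mod_eq_of_lt z.2] at h2
    exact Fin.ext h2
  set H : ℤ → ℝ := fun j => if J ≤ j.natAbs then 1 / (4 * ((j.natAbs : ℝ) - 1 / 2) ^ 2) else 0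
  have hH : ∀ j, 0 ≤ H j := fun j => by
    simp only [H]
    split_ifs <;> positivity
  refine le_trans ?_ (sum_Icc_inv_sq_tail_le hJ M)
  have step : ∀ y : Fin M, (if ε < |Real.sin (Real.pi * (y : ℕ) / M - θ)| then
      ‖phaseCoeff M θ y‖ ^ 2 else 0) ≤ H (g y) := by
    intro y
    split_ifs with hy
    swap
    · exact hH _
    obtain ⟨hb1, hb2⟩ := abs_sin_pi_div_sub_bounds θ ((y : ℕ) : ℤ) (g y) rfl
    have hc := norm_phaseCoeff_mul_le M θ y
    rw [Int.cast_natCast] at hb1 hb2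
    set s := |Real.sin (Real.pi * (y : ℕ) / M - θ)|
    have hJn : J ≤ (g y).natAbs := by
      have h1 : M * ε < Real.pi * ((g y).natAbs + 1 / 2) := by
        have h := hy.trans_le hb2
        rw [lt_div_iff₀ hM] at h
        linarith
      have h2 : (J : ℝ) < (g y).natAbs + 1 / 2 := lt_of_mul_lt_mul_left (hε.trans_lt h1) hπ.le
      have h3 : (J : ℝ) < ((g y).natAbs + 1 : ℕ) := by
        push_cast
        linarith
      have := Nat.cast_lt.mp h3
      omega
    simp only [H, if_pos hJn]
    have hn : (2 : ℝ) ≤ (g y).natAbs := by exact_mod_cast hJ.trans hJn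
    have h4 : 2 * (((g y).natAbs : ℝ) - 1 / 2) ≤ M * s := by
      rw [div_le_iff₀ hM] at hb1
      linarith
    have h5 : ‖phaseCoeff M θ y‖ ≤ 1 / (2 * (((g y).natAbs : ℝ) - 1 / 2)) := by
      rw [le_div_iff₀ (by linarith)]
      exact le_trans (by gcongr) hc
    calc ‖phaseCoeff M θ y‖ ^ 2 ≤ (1 / (2 * (((g y).natAbs : ℝ) - 1 / 2))) ^ 2 := by gcongr
      _ = _ := by rw [div_pow, mul_pow]; norm_num
  refine (Finset.sum_le_sum fun y _ => step y).trans ?_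
  rw [← Finset.sum_image (f := H) (g := g) (s := Finset.univ) fun a _ b _ h => hinj h]
  refine Finset.sum_le_sum_of_subset_of_nonneg ?_ fun j _ _ => hH j
  intro j hj
  obtain ⟨y, -, rfl⟩ := Finset.mem_image.mp hj
  have := ZMod.natAbs_valMinAbs_le (((y : ℕ) - y0 : ℤ) : ZMod M)
  have h2 : (g y).natAbs ≤ M := this.trans (Nat.div_le_self _ _)
  rw [Finset.mem_Icc]
  omega

/-! ### Amplitude estimation and the mean of cosines -/

namespace QAlg

variable {I J α β : Type}

/-- Powers of the Grover iterate act on the amplitude at `w` by a scalar depending only on whether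
`w` is good, so no eigenvectors are needed. -/
theorem amp_ampEst (A : QAlg I α) (χ : α → Bool) (M : ℕ) [NeZero M] (i : I) (y : Fin M)
    (w : A.W) :
    (A.ampEst χ M).amp i (y, w) =
      (∑ k : Fin M, Complex.exp (-(2 * Real.pi * Complex.I * (k : ℕ) * (y : ℕ) / M)) / M *
        ((if χ (A.read w) then (groverCoeff (A.prob χ i) k).1
          else (groverCoeff (A.prob χ i) k).2 : ℝ) : ℂ)) * A.amp i w := by
  have hM : (0 : ℝ) ≤ M := Nat.cast_nonneg M
  have hs : ((Real.sqrt M : ℝ) : ℂ) * ((Real.sqrt M : ℝ) : ℂ) = M := by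
    rw [← Complex.ofReal_mul, Real.mul_self_sqrt hM]
    simp
  have h1 : (A.ampEst χ M).amp i (y, w) = ∑ k : Fin M,
      star (Complex.exp (2 * Real.pi * Complex.I * (k : ℕ) * (y : ℕ) / M) / (Real.sqrt M : ℝ)) *
      ((((A.grover χ i ^ (k : ℕ) : Matrix.unitaryGroup A.W ℂ) : Matrix A.W A.W ℂ) *ᵥ
        A.amp i) w * (1 / (Real.sqrt M : ℝ))) := by
    simp only [amp, ampEst]
    rw [Matrix.UnitaryGroup.mul_val, Matrix.UnitaryGroup.mul_val, Matrix.mul_assoc,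
      Matrix.mul_apply, Fintype.sum_prod_type]
    refine Finset.sum_congr rfl fun k _ => ?_
    rw [Finset.sum_eq_single w]
    · congr 1
      · simp only [QGate.tensor, Matrix.kronecker, Matrix.kroneckerMap_apply,
          Matrix.UnitaryGroup.one_val, Matrix.one_apply_eq, mul_one,
          Matrix.UnitaryGroup.inv_val, Matrix.star_apply, QGate.qft, Matrix.of_apply]
      · rw [Matrix.mul_apply, Fintype.sum_prod_type, Finset.sum_eq_single k]
        · simp only [QGate.ctrl, QGate.tensor, Matrix.of_apply, if_true, Matrix.kronecker,
            Matrix.kroneckerMap_apply, Matrix.mulVec, dotProduct, Finset.sum_mul]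
          refine Finset.sum_congr rfl fun u _ => ?_
          simp only [QGate.qft, Matrix.of_apply, Fin.val_zero, Nat.cast_zero, mul_zero, zero_div,
            Complex.exp_zero, amp]
          ring
        · intro l _ hl
          refine Finset.sum_eq_zero fun u _ => ?_
          simp [QGate.ctrl, Ne.symm hl]
        · simp
    · intro u _ hu
      simp [QGate.tensor, Matrix.kronecker, Matrix.one_apply_ne (Ne.symm hu)]
    · simp
  rw [h1, Finset.sum_mul]
  refine Finset.sum_congr rfl fun k _ => ?_
  rw [grover_pow_mulVec]
  have e1 : star (Complex.exp (2 * Real.pi * Complex.I * (k : ℕ) * (y : ℕ) / M) /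
      (Real.sqrt M : ℝ)) =
      Complex.exp (-(2 * Real.pi * Complex.I * (k : ℕ) * (y : ℕ) / M)) / (Real.sqrt M : ℝ) := by
    rw [← starRingEnd_apply, map_div₀, ← Complex.exp_conj, Complex.conj_ofReal]
    congr 2
    have h3 : (starRingEnd ℂ) 2 = 2 := map_ofNat _ 2
    simp only [map_div₀, map_mul, h3, Complex.conj_ofReal, Complex.conj_I, Complex.conj_natCast]
    ring
  rw [e1, ← hs]
  ring

/-- The distribution of the outcome of phase estimation for the Grover iterate. -/
theorem sum_norm_sq_amp_ampEst (A : QAlg I α) (χ : α → Bool) (M : ℕ) [NeZero M] (i : I)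
    (θ : ℝ) (hθ : A.prob χ i = Real.sin θ ^ 2) (y : Fin M) :
    ∑ w, ‖(A.ampEst χ M).amp i (y, w)‖ ^ 2 =
      (‖phaseCoeff M θ y‖ ^ 2 + ‖phaseCoeff M (-θ) y‖ ^ 2) / 2 := by
  set e : Fin M → ℂ := fun k =>
    Complex.exp (-(2 * Real.pi * Complex.I * (k : ℕ) * (y : ℕ) / M)) / M with he
  set X : ℂ := ∑ k : Fin M, e k * ((groverCoeff (A.prob χ i) k).1 : ℂ) with hX
  set Y : ℂ := ∑ k : Fin M, e k * ((groverCoeff (A.prob χ i) k).2 : ℂ) with hY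
  have h1 : ∑ w, ‖(A.ampEst χ M).amp i (y, w)‖ ^ 2 =
      ‖X‖ ^ 2 * A.prob χ i + ‖Y‖ ^ 2 * (1 - A.prob χ i) := by
    rw [← prob_not]
    simp only [prob, expect]
    rw [Finset.mul_sum, Finset.mul_sum, ← Finset.sum_add_distrib]
    refine Finset.sum_congr rfl fun w _ => ?_
    rw [amp_ampEst, norm_mul, mul_pow]
    by_cases hw : χ (A.read w) = true <;> simp [hX, hY, he, hw]
  have hs : X * (Real.sin θ : ℝ) = ∑ k : Fin M, e k * (Real.sin ((2 * (k : ℕ) + 1) * θ) : ℝ) := by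
    rw [hX, Finset.sum_mul, hθ]
    refine Finset.sum_congr rfl fun k _ => ?_
    rw [mul_assoc, ← Complex.ofReal_mul, (groverCoeff_mul θ k).1]
  have hc : Y * (Real.cos θ : ℝ) = ∑ k : Fin M, e k * (Real.cos ((2 * (k : ℕ) + 1) * θ) : ℝ) := by
    rw [hY, Finset.sum_mul, hθ]
    refine Finset.sum_congr rfl fun k _ => ?_
    rw [mul_assoc, ← Complex.ofReal_mul, (groverCoeff_mul θ k).2]
  have hp : phaseCoeff M θ y = Y * (Real.cos θ : ℝ) + Complex.I * (X * (Real.sin θ : ℝ)) := by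
    rw [hs, hc, Finset.mul_sum, ← Finset.sum_add_distrib, phaseCoeff]
    refine Finset.sum_congr rfl fun k _ => ?_
    rw [mul_comm Complex.I, Complex.exp_mul_I]
    push_cast
    ring
  have hm : phaseCoeff M (-θ) y = Y * (Real.cos θ : ℝ) - Complex.I * (X * (Real.sin θ : ℝ)) := by
    rw [hs, hc, Finset.mul_sum, ← Finset.sum_sub_distrib, phaseCoeff]
    refine Finset.sum_congr rfl fun k _ => ?_
    rw [mul_comm Complex.I, Complex.exp_mul_I]
    push_cast
    rw [mul_neg, Complex.cos_neg, Complex.sin_neg]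
    ring
  -- The coefficients at `θ` and `-θ` are the sum and the difference of the same two numbers; the
  -- parallelogram law gives the equal mixture.
  have hpar := parallelogram_law_with_norm ℝ (Y * (Real.cos θ : ℝ))
    (Complex.I * (X * (Real.sin θ : ℝ)))
  have hcos : 1 - Real.sin θ ^ 2 = Real.cos θ ^ 2 := by
    rw [Real.cos_sq']
  rw [h1, hp, hm, hθ, hcos, hpar]
  simp only [norm_mul, Complex.norm_I, Complex.norm_real, Real.norm_eq_abs, one_mul]
  rw [← sq_abs (Real.sin θ), ← sq_abs (Real.cos θ)]
  ring

theorem ampEst_error_le (A : QAlg I α) (χ : α → Bool) {M J : ℕ} [NeZero M] (hJ : 2 ≤ J) (i : I)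
    {ε : ℝ} (hε : Real.pi * J ≤ M * ε) :
    (A.ampEst χ M).expect i (fun e => if ε < |e - A.prob χ i| then 1 else 0) ≤
      1 / (2 * ((J : ℝ) - 1)) := by
  obtain ⟨θ, hθ⟩ : ∃ θ, A.prob χ i = Real.sin θ ^ 2 := by
    refine ⟨Real.arcsin (Real.sqrt (A.prob χ i)), ?_⟩
    rw [Real.sin_arcsin, Real.sq_sqrt (A.prob_nonneg χ i)]
    · linarith [Real.sqrt_nonneg (A.prob χ i)]
    · exact Real.sqrt_le_one.mpr (A.prob_le_one χ i)
  have h1 : (A.ampEst χ M).expect i (fun e => if ε < |e - A.prob χ i| then 1 else 0) =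
      ∑ y : Fin M, (‖phaseCoeff M θ y‖ ^ 2 + ‖phaseCoeff M (-θ) y‖ ^ 2) / 2 *
        (if ε < |Real.sin (Real.pi * ((y : ℕ) : ℝ) / M) ^ 2 - Real.sin θ ^ 2| then 1 else 0) := by
    rw [expect]
    refine (Fintype.sum_prod_type _).trans ?_
    refine Finset.sum_congr rfl fun y _ => ?_
    rw [← sum_norm_sq_amp_ampEst A χ M i θ hθ, Finset.sum_mul, hθ]
    rfl
  have h2 := sum_phaseCoeff_tail_le hJ θ ε hε
  have h3 := sum_phaseCoeff_tail_le hJ (-θ) ε hε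
  have h4 : ∀ y : Fin M, (‖phaseCoeff M θ y‖ ^ 2 + ‖phaseCoeff M (-θ) y‖ ^ 2) / 2 *
      (if ε < |Real.sin (Real.pi * ((y : ℕ) : ℝ) / M) ^ 2 - Real.sin θ ^ 2| then 1 else 0) ≤
      ((if ε < |Real.sin (Real.pi * (y : ℕ) / M - θ)| then ‖phaseCoeff M θ y‖ ^ 2 else 0) +
      (if ε < |Real.sin (Real.pi * (y : ℕ) / M - -θ)| then ‖phaseCoeff M (-θ) y‖ ^ 2 else 0)) /
        2 := by
    intro y
    -- Each factor has modulus at most `1`, so a large error of the estimate means a large error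
    -- with respect to both phases `θ` and `-θ`.
    have e : Real.sin (Real.pi * ((y : ℕ) : ℝ) / M) ^ 2 - Real.sin θ ^ 2 =
        Real.sin (Real.pi * (y : ℕ) / M - θ) * Real.sin (Real.pi * (y : ℕ) / M - -θ) := by
      rw [sub_neg_eq_add, Real.sin_sub, Real.sin_add]
      linear_combination (Real.sin θ ^ 2) * Real.sin_sq_add_cos_sq (Real.pi * (y : ℕ) / M) -
        (Real.sin (Real.pi * (y : ℕ) / M) ^ 2) * Real.sin_sq_add_cos_sq θ
    rw [e, abs_mul]
    by_cases h : ε < |Real.sin (Real.pi * (y : ℕ) / M - θ)| *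
        |Real.sin (Real.pi * (y : ℕ) / M - -θ)|
    · rw [if_pos h, if_pos (h.trans_le (mul_le_of_le_one_right (abs_nonneg _)
        (Real.abs_sin_le_one _))), if_pos (h.trans_le (mul_le_of_le_one_left (abs_nonneg _)
        (Real.abs_sin_le_one _))), mul_one]
    · rw [if_neg h, mul_zero]
      positivity
  rw [h1]
  refine (Finset.sum_le_sum fun y _ => h4 y).trans ?_
  rw [← Finset.sum_div, Finset.sum_add_distrib]
  linarith

theorem abs_median_sub_le {r : ℕ} (f : Fin (2 * r + 1) → ℝ) (μ ε : ℝ)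
    (h : ∀ k, |f k - μ| ≤ ε) : |median f - μ| ≤ ε := h _

/-- The median is one of the values, so a union bound over all runs suffices; single runs fail
rarely enough for this crude bound. -/
theorem expect_median_error_le (A : QAlg I ℝ) (i : I) (r : ℕ) (μ ε δ : ℝ)
    (h : A.expect i (fun e => if ε < |e - μ| then 1 else 0) ≤ δ) :
    ((par fun _ : Fin (2 * r + 1) => A).map median).expect i
      (fun e => if ε < |e - μ| then 1 else 0) ≤ (2 * r + 1) * δ := by
  rw [expect_map]
  refine le_trans (expect_mono (g := fun o => ∑ k,
    if ε < |o k - μ| then 1 else 0) _ _ fun o => ?_) ?_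
  · by_cases h : ∀ k, |o k - μ| ≤ ε
    · have := abs_median_sub_le o _ _ h
      rw [Function.comp_apply, if_neg (not_lt.mpr this)]
      exact Finset.sum_nonneg fun k _ => by split_ifs <;> norm_num
    · push Not at h
      obtain ⟨k, hk⟩ := h
      refine le_trans ?_ (Finset.single_le_sum (fun k _ => by split_ifs <;> norm_num)
        (Finset.mem_univ k))
      rw [if_pos hk, Function.comp_apply]
      split_ifs <;> norm_num
  · rw [expect_sum]
    have hk : ∀ k ∈ (Finset.univ : Finset (Fin (2 * r + 1))),
        (par fun _ : Fin (2 * r + 1) => A).expect i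
          (fun o => if ε < |o k - μ| then 1 else 0) ≤ δ := fun k _ =>
      (expect_par_single (fun _ : Fin (2 * r + 1) => A) i k
        fun e => if ε < |e - μ| then 1 else 0).trans_le h
    refine (Finset.sum_le_card_nsmul _ _ _ hk).trans_eq ?_
    simp only [Finset.card_univ, Fintype.card_fin, nsmul_eq_mul]
    push_cast
    ring

/-- The estimate of the mean is precise with probability at least `9/10`. -/
theorem meanCos_error_le {D : ℕ} [NeZero D] {ι : Type} [Fintype ι] (q : ℝ)
    (w : I → Fin D → ι → ℝ) (v : I → ι → ℝ) {ε : ℝ} (hε : 0 < ε) (i : I) :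
    (meanCos q w v ε (1 / 10)).expect i (fun e =>
      if ε < |e - (∑ j, Real.cos (2 * Real.pi * (w i j ⬝ᵥ v i) / q)) / D| then 1 else 0) ≤
      1 / 10 := by
  set γ : I → Fin D → ℝ := fun i j => Real.cos (2 * Real.pi * (w i j ⬝ᵥ v i) / q) with hγ
  set M : ℕ := ⌈10000 / ε⌉₊ + 1 with hM
  have hγ1 : ∀ i j, γ i j ≤ 1 := fun i j => Real.cos_le_one _
  have hγ2 : ∀ i j, (-γ) i j ≤ 1 := fun i j => by
    have := Real.neg_one_le_cos (2 * Real.pi * (w i j ⬝ᵥ v i) / q)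
    simp only [Pi.neg_apply, hγ]
    linarith
  -- With `10000 / ε` points, `M ε / 2 ≥ 5000 > 1000 π`. Tail parameter `J = 1000` then gives
  -- failure probability `1/1998` for each sign.
  have hMε : Real.pi * (1000 : ℕ) ≤ M * (ε / 2) := by
    have h1 : 10000 / ε ≤ M := by
      rw [hM]
      push_cast
      linarith [Nat.le_ceil (10000 / ε)]
    rw [div_le_iff₀ hε] at h1
    have := Real.pi_lt_four
    push_cast
    linarith
  have hest : ∀ a : I → Fin D → ℝ, (∀ i j, a i j ≤ 1) →
      ((rotated a).ampEst Prod.snd M).expect i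
        (fun e => if ε / 2 < |e - (∑ j, max 0 (a i j)) / D| then 1 else 0) ≤ 1 / 1998 := by
    intro a ha
    have h := ampEst_error_le (rotated a) Prod.snd (J := 1000) (by norm_num) i hMε
    rw [prob, expect_rotated a ha] at h
    exact h.trans_eq (by norm_num)
  set est : Bool → QAlg I ℝ := fun pos =>
    (rotated (if pos then γ else -γ)).ampEst Prod.snd M with hest'
  have hμ : (∑ j, γ i j) / D = (∑ j, max 0 (γ i j)) / D - (∑ j, max 0 ((-γ) i j)) / D := by
    rw [← sub_div, ← Finset.sum_sub_distrib]
    congr 1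
    refine Finset.sum_congr rfl fun j _ => ?_
    simp only [Pi.neg_apply]
    rcases le_total 0 (γ i j) with h | h
    · rw [max_eq_right h, max_eq_left (by linarith)]
      ring
    · rw [max_eq_left h, max_eq_right (by linarith)]
      ring
  have hrun : ((par est).map fun e => e true - e false).expect i
      (fun e => if ε < |e - (∑ j, γ i j) / D| then 1 else 0) ≤ 1 / 999 := by
    rw [expect_map]
    have h1 := expect_par_single est i true
      (fun e => if ε / 2 < |e - (∑ j, max 0 (γ i j)) / D| then 1 else 0)
    have h2 := expect_par_single est i false
      (fun e => if ε / 2 < |e - (∑ j, max 0 ((-γ) i j)) / D| then 1 else 0)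
    have h3 := hest γ hγ1
    have h4 := hest (-γ) hγ2
    have h5 : (par est).expect i ((fun e => if ε < |e - (∑ j, γ i j) / D| then (1 : ℝ) else 0) ∘
        fun e => e true - e false) ≤ (par est).expect i (fun o => ∑ b : Bool,
        if b then (if ε / 2 < |o true - (∑ j, max 0 (γ i j)) / D| then (1 : ℝ) else 0)
        else (if ε / 2 < |o false - (∑ j, max 0 ((-γ) i j)) / D| then 1 else 0)) := by
      refine expect_mono _ _ fun o => ?_
      simp only [Function.comp_apply, Fintype.sum_bool, if_true, Bool.false_eq_true, if_false, hμ]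
      generalize (∑ j, max 0 (γ i j)) / (D : ℝ) = a
      generalize (∑ j, max 0 ((-γ) i j)) / (D : ℝ) = b
      split_ifs with ha hb hc hc <;> norm_num
      have e : o true - o false - (a - b) = (o true - a) - (o false - b) := by ring
      rw [e] at ha
      have := abs_sub (o true - a) (o false - b)
      linarith
    rw [expect_sum, Fintype.sum_bool] at h5
    simp only [if_true, Bool.false_eq_true, if_false] at h5
    rw [h1, h2] at h5
    refine h5.trans ?_
    refine (add_le_add h3 h4).trans ?_
    norm_num
  -- Hence at most 19 runs enter the median, and `19 / 999 ≤ 1/10`.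
  have hr : ⌈Real.log (1 / (1 / 10))⌉₊ ≤ 9 := by
    rw [Nat.ceil_le]
    have := Real.log_le_sub_one_of_pos (x := 1 / (1 / 10)) (by norm_num)
    refine this.trans ?_
    norm_num
  refine (expect_median_error_le _ i ⌈Real.log (1 / (1 / 10))⌉₊ _ ε _ hrun).trans ?_
  have hr' : (⌈Real.log (1 / (1 / 10))⌉₊ : ℝ) ≤ 9 := by exact_mod_cast hr
  linarith

end QAlg

namespace QAlg

variable {I J α β : Type}

/-! ### Majority votes -/

/-- A union bound over the sets of `s + 1` runs, of which there are at most `4 ^ s`. The predicate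
`χ` allows wrong acceptances and wrong rejections alike. -/
theorem expect_many_le (B : QAlg I Bool) (i : I) (s : ℕ) (χ : Bool → Bool) :
    (par fun _ : Fin (2 * s + 1) => B).expect i
      (fun o => if s < (Finset.univ.filter fun k => χ (o k) = true).card then 1 else 0) ≤
      4 ^ s * B.prob χ i ^ (s + 1) := by
  set f : Bool → ℝ := fun b => if χ b = true then 1 else 0 with hf
  have hf0 : ∀ b, 0 ≤ f b := fun b => by simp only [hf]; split_ifs <;> norm_num
  refine le_trans (expect_mono (g := fun o =>
    ∑ T ∈ Finset.powersetCard (s + 1) (Finset.univ : Finset (Fin (2 * s + 1))),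
      ∏ k, (if k ∈ T then f else fun _ => 1) (o k)) _ _ fun o => ?_) ?_
  · have h0 : ∀ T : Finset (Fin (2 * s + 1)),
        0 ≤ ∏ k, (if k ∈ T then f else fun _ => 1) (o k) := fun T =>
      Finset.prod_nonneg fun k _ => by
        split_ifs
        · exact hf0 _
        · norm_num
    split_ifs with h
    · obtain ⟨T, hT, hTc⟩ := Finset.exists_subset_card_eq (Nat.succ_le_of_lt h)
      refine le_trans (le_of_eq ?_) (Finset.single_le_sum (fun T _ => h0 T)
        (Finset.mem_powersetCard.mpr ⟨Finset.subset_univ T, hTc⟩))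
      symm
      refine Finset.prod_eq_one fun k _ => ?_
      split_ifs with hk
      · simpa [hf] using (Finset.mem_filter.mp (hT hk)).2
      · rfl
    · exact Finset.sum_nonneg fun T _ => h0 T
  · rw [expect_sum]
    have h : ∀ T ∈ Finset.powersetCard (s + 1) (Finset.univ : Finset (Fin (2 * s + 1))),
        (par fun _ : Fin (2 * s + 1) => B).expect i
          (fun o => ∏ k, (if k ∈ T then f else fun _ => 1) (o k)) ≤ B.prob χ i ^ (s + 1) := by
      intro T hT
      rw [expect_par_prod (fun _ : Fin (2 * s + 1) => B) i
        fun k => if k ∈ T then f else fun _ => 1]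
      refine le_of_eq ?_
      have e : ∀ k, B.expect i (if k ∈ T then f else fun _ => 1) =
          if k ∈ T then B.prob χ i else 1 := fun k => by
        split_ifs
        · rfl
        · exact expect_const _ _ _
      simp only [e, Finset.prod_ite_mem, Finset.univ_inter, Finset.prod_const,
        (Finset.mem_powersetCard.mp hT).2]
    refine (Finset.sum_le_card_nsmul _ _ _ h).trans ?_
    rw [Finset.card_powersetCard, Finset.card_univ, Fintype.card_fin, Nat.choose_symm_half,
      nsmul_eq_mul]
    refine mul_le_mul_of_nonneg_right ?_ (pow_nonneg (B.prob_nonneg χ i) _)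
    exact_mod_cast Nat.choose_middle_le_pow s

theorem expect_many_le_of_le (B : QAlg I Bool) (i : I) (s : ℕ) (χ : Bool → Bool)
    (h : B.prob χ i ≤ 1 / 10) :
    (par fun _ : Fin (2 * s + 1) => B).expect i
      (fun o => if s < (Finset.univ.filter fun k => χ (o k) = true).card then 1 else 0) ≤
      (2 / 5) ^ s / 10 := by
  refine (expect_many_le B i s χ).trans ?_
  calc (4 : ℝ) ^ s * B.prob χ i ^ (s + 1) ≤ 4 ^ s * (1 / 10) ^ (s + 1) := by
        gcongr
        exact B.prob_nonneg χ i
    _ = (2 / 5) ^ s / 10 := by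
        rw [pow_succ, ← mul_assoc, ← mul_pow]
        norm_num
        ring

theorem majority_prob_le (B : QAlg I Bool) (i : I) (s : ℕ) (h : B.prob id i ≤ 1 / 10) :
    (majority s B).prob id i ≤ (2 / 5) ^ s / 10 := by
  refine le_trans (le_of_eq ?_) (expect_many_le_of_le B i s id h)
  rw [prob, majority, expect_map]
  congr 1
  funext o
  simp

theorem le_majority_prob (B : QAlg I Bool) (i : I) (s : ℕ) (h : 9 / 10 ≤ B.prob id i) :
    1 - (2 / 5) ^ s / 10 ≤ (majority s B).prob id i := by
  have h1 : B.prob (fun b => !b) i ≤ 1 / 10 := by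
    have := B.prob_not id i
    simp only [id] at this
    rw [this]
    have h' : 9 / 10 ≤ B.prob (fun b => b) i := h
    linarith
  have h2 := expect_many_le_of_le B i s (fun b => !b) h1
  have h3 : 1 - (majority s B).prob id i ≤ (par fun _ : Fin (2 * s + 1) => B).expect i
      (fun o => if s < (Finset.univ.filter fun k => (!(o k)) = true).card then 1 else 0) := by
    rw [prob, majority, expect_map, ← expect_one_sub]
    refine expect_mono _ _ fun o => ?_
    have hc := Finset.card_filter_add_card_filter_not (s := Finset.univ) fun k => o k = true
    simp only [Finset.card_univ, Fintype.card_fin] at hc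
    have hf : (Finset.univ.filter fun k => (!(o k)) = true) =
        Finset.univ.filter fun k => ¬ o k = true := by
      ext k
      simp
    rw [← hf] at hc
    simp only [Function.comp_apply, id, decide_eq_true_eq]
    split_ifs <;> first | omega | norm_num
  linarith

/-! ### Quantum search -/

/-- The expectation of `f` of the index, on the event that stage `k` raises its flag. -/
noncomputable def flagWeight {N : ℕ} [NeZero N] (t : ℕ) (B : QAlg (I × Fin N) Bool) (i : I)
    (k : ℕ) (f : Fin N → ℝ) : ℝ :=
  (searchStage t B k).expect i fun o => if o.2 = true then f o.1 else 0

section Search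

variable {N : ℕ} [NeZero N] (t : ℕ) (B : QAlg (I × Fin N) Bool) (i : I)

theorem flagWeight_zero (f : Fin N → ℝ) :
    flagWeight t B i 0 f = (∑ j, (majority t B).prob id (i, j) * f j) / N := by
  rw [flagWeight, searchStage, expect_andThen, expect_unif]
  congr 1
  refine Finset.sum_congr rfl fun j _ => ?_
  rw [prob, mul_comm, ← expect_const_mul]
  congr 1
  funext b
  simp

/-- Amplification scales all flagged indices by a common factor; the fresh vote then multiplies each
by its own acceptance probability. -/
theorem flagWeight_succ (k : ℕ) (f : Fin N → ℝ) :
    flagWeight t B i (k + 1) f = (3 - 4 * flagWeight t B i k fun _ => 1) ^ 2 *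
      flagWeight t B i k fun j => (majority (t + (k + 1)) B).prob id (i, j) * f j := by
  have h : flagWeight t B i (k + 1) f = ((searchStage t B k).amplify Prod.snd).expect i
      (fun o => if o.2 = true then (majority (t + (k + 1)) B).prob id (i, o.1) * f o.1
        else 0) := by
    rw [flagWeight, searchStage, expect_map, expect_andThen]
    congr 1
    funext o
    rw [expect_comap]
    simp only [Function.comp_apply]
    cases o.2
    · simp [expect_const]
    · rw [if_pos rfl, prob, mul_comm, ← expect_const_mul]
      congr 1
      funext b
      simp
  rw [h, expect_amplify _ _ _ _ fun a ha => by simp [ha]]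
  rfl

theorem flagWeight_mono (k : ℕ) {f g : Fin N → ℝ} (h : ∀ j, f j ≤ g j) :
    flagWeight t B i k f ≤ flagWeight t B i k g :=
  expect_mono _ _ fun o => by
    split_ifs
    · exact h _
    · exact le_rfl

theorem flagWeight_nonneg (k : ℕ) {f : Fin N → ℝ} (h : ∀ j, 0 ≤ f j) :
    0 ≤ flagWeight t B i k f :=
  expect_nonneg _ _ fun o => by
    split_ifs
    · exact h _
    · exact le_rfl

theorem flagWeight_one_le (k : ℕ) : flagWeight t B i k (fun _ => 1) ≤ 1 :=
  expect_le_one _ _ fun o => by split_ifs <;> norm_num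

theorem flagWeight_const_mul (k : ℕ) (c : ℝ) (f : Fin N → ℝ) :
    flagWeight t B i k (fun j => c * f j) = c * flagWeight t B i k f := by
  rw [flagWeight, flagWeight, ← expect_const_mul]
  congr 1
  funext o
  split_ifs <;> simp

theorem two_fifths_pow_le {t : ℕ} (ht : 10 ≤ t) : (2 / 5 : ℝ) ^ t ≤ 1 / 9000 :=
  (pow_le_pow_of_le_one (by norm_num) (by norm_num) ht).trans (by norm_num)

/-- Per stage, a gain of at most `9` meets a false confirmation rate of at most `1/90000`, well
below the claimed ratio `1/100`. -/
theorem flagWeight_bad_le {t : ℕ} (ht : 10 ≤ t) (bad : Fin N → Prop) [DecidablePred bad]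
    (hbad : ∀ j, bad j → B.prob id (i, j) ≤ 1 / 10) (k : ℕ) :
    flagWeight t B i k (fun j => if bad j then 1 else 0) ≤
      (2 / 5) ^ t / 10 * (1 / 100) ^ k := by
  have hm : ∀ s j, (majority s B).prob id (i, j) * (if bad j then 1 else 0) ≤
      (2 / 5) ^ s / 10 * (if bad j then 1 else 0) := by
    intro s j
    split_ifs with h
    · rw [mul_one, mul_one]
      exact majority_prob_le B _ s (hbad j h)
    · simp
  induction k with
  | zero =>
    rw [flagWeight_zero, pow_zero, mul_one, div_le_iff₀ (Nat.cast_pos.mpr (Nat.pos_of_neZero N))]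
    have h : ∀ j ∈ (Finset.univ : Finset (Fin N)),
        (majority t B).prob id (i, j) * (if bad j then 1 else 0) ≤ (2 / 5) ^ t / 10 := by
      intro j _
      refine (hm t j).trans (mul_le_of_le_one_right (by positivity) ?_)
      split_ifs <;> norm_num
    refine (Finset.sum_le_card_nsmul _ _ _ h).trans_eq ?_
    rw [Finset.card_univ, Fintype.card_fin, nsmul_eq_mul, mul_comm]
  | succ k ih =>
    rw [flagWeight_succ]
    have h1 := flagWeight_one_le t B i k
    have h0 := flagWeight_nonneg t B i k (f := fun _ => 1) fun _ => zero_le_one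
    have h2 := flagWeight_mono t B i k (hm (t + (k + 1)))
    rw [flagWeight_const_mul] at h2
    have hW := flagWeight_nonneg t B i k (f := fun j => if bad j then (1 : ℝ) else 0)
      fun j => by split_ifs <;> norm_num
    have h3 := two_fifths_pow_le (show 10 ≤ t + (k + 1) by omega)
    have h4 : (3 - 4 * flagWeight t B i k fun _ => 1) ^ 2 ≤ 9 := by nlinarith
    set W := flagWeight t B i k (fun j => if bad j then (1 : ℝ) else 0)
    calc _ ≤ 9 * ((2 / 5) ^ (t + (k + 1)) / 10 * W) := by
          gcongr
          exact flagWeight_nonneg t B i k fun j => mul_nonneg (prob_nonneg _ _ _)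
            (by split_ifs <;> norm_num)
      _ ≤ 9 * (1 / 9000 / 10 * W) := by gcongr
      _ ≤ 1 / 100 * W := by linarith
      _ ≤ 1 / 100 * ((2 / 5) ^ t / 10 * (1 / 100) ^ k) := by gcongr
      _ = _ := by rw [pow_succ]; ring

theorem sum_fin_mul_div (a n : ℕ) (ha : 0 < a) (g : ℕ → ℝ) :
    ∑ k : Fin (a * n), g ((k : ℕ) / a) = a * ∑ k ∈ Finset.range n, g k := by
  rw [Fin.sum_univ_eq_sum_range fun k => g (k / a)]
  induction n with
  | zero => simp
  | succ n ih =>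
    rw [Nat.mul_succ, Finset.sum_range_add, ih, Finset.sum_range_succ, mul_add]
    congr 1
    rw [Finset.sum_congr rfl (g := fun _ => g n) fun x hx => by
      rw [Nat.mul_add_div ha, Nat.div_eq_of_lt (Finset.mem_range.mp hx), add_zero]]
    simp

/-- Quantum search rarely returns a bad index. -/
theorem search_bad_le {t : ℕ} (ht : 10 ≤ t) (bad : Fin N → Prop) [DecidablePred bad]
    (hbad : ∀ j, bad j → B.prob id (i, j) ≤ 1 / 10) :
    (search t B).expect i (fun r => r.elim 0 fun j => if bad j then 1 else 0) ≤
      5 * (2 / 5) ^ t := by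
  rw [search, expect_map]
  -- A returned bad index was flagged by some run. The union bound costs `40 · (1/10) · (100/99) <
  -- 5`.
  refine le_trans (expect_mono (g := fun o => ∑ k,
    if (o k).2 = true then (if bad (o k).1 then 1 else 0) else 0) _ _ fun o => ?_) ?_
  · have h0 : ∀ k, (0 : ℝ) ≤ if (o k).2 = true then (if bad (o k).1 then 1 else 0) else 0 :=
      fun k => by split_ifs <;> norm_num
    rw [Function.comp_apply]
    rcases h : (List.ofFn o).find? Prod.snd with _ | a
    · exact Finset.sum_nonneg fun k _ => h0 k
    · obtain ⟨k, hk⟩ := (List.mem_ofFn' o a).mp (List.mem_of_find?_eq_some h)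
      have h2 := List.find?_some h
      refine le_trans (le_of_eq ?_) (Finset.single_le_sum (fun k _ => h0 k) (Finset.mem_univ k))
      rw [hk, if_pos h2]
      rfl
  · rw [expect_sum]
    have h1 : ∀ k : Fin (40 * (Nat.clog 9 N + 1)),
        (par fun k : Fin (40 * (Nat.clog 9 N + 1)) => searchStage t B ((k : ℕ) / 40)).expect i
          (fun o => if (o k).2 = true then (if bad (o k).1 then (1 : ℝ) else 0) else 0) =
        flagWeight t B i ((k : ℕ) / 40) (fun j => if bad j then 1 else 0) := fun k =>
      expect_par_single (fun k : Fin (40 * (Nat.clog 9 N + 1)) => searchStage t B ((k : ℕ) / 40))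
        i k fun o => if o.2 = true then (if bad o.1 then (1 : ℝ) else 0) else 0
    rw [Finset.sum_congr rfl fun k _ => h1 k, sum_fin_mul_div 40 _ (by norm_num)
      fun k => flagWeight t B i k fun j => if bad j then 1 else 0]
    have h2 : ∑ k ∈ Finset.range (Nat.clog 9 N + 1),
        flagWeight t B i k (fun j => if bad j then (1 : ℝ) else 0) ≤
        (2 / 5) ^ t / 10 * (100 / 99) := by
      refine (Finset.sum_le_sum fun k _ => flagWeight_bad_le B i ht bad hbad k).trans ?_
      rw [← Finset.mul_sum]
      gcongr
      rw [geom_sum_eq (by norm_num), div_le_iff_of_neg (by norm_num)]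
      have : (0 : ℝ) ≤ (1 / 100) ^ (Nat.clog 9 N + 1) := by positivity
      linarith
    have h3 : (0 : ℝ) ≤ (2 / 5) ^ t := by positivity
    push_cast
    linarith

/-- Ideal growth is ninefold per stage. The losses are charged additively: the vote errors, and
`8/3` times the flagged weight, since `(3 - 4P)² ≥ 9 (1 - 8P/3)`. -/
theorem le_flagWeight_of_good (j₀ : Fin N) (h : 9 / 10 ≤ B.prob id (i, j₀)) (k : ℕ) :
    9 ^ k * (1 - ∑ l ∈ Finset.range (k + 1), (2 / 5 : ℝ) ^ (t + l) / 10 -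
      8 / 3 * ∑ l ∈ Finset.range k, flagWeight t B i l fun _ => 1) ≤
      N * flagWeight t B i k fun j => if j = j₀ then 1 else 0 := by
  have hN : (0 : ℝ) < N := Nat.cast_pos.mpr (Nat.pos_of_neZero N)
  induction k with
  | zero =>
    rw [flagWeight_zero, mul_div_cancel₀ _ hN.ne']
    simpa using le_majority_prob B (i, j₀) t h
  | succ k ih =>
    have hu := flagWeight_nonneg t B i k (f := fun j => if j = j₀ then 1 else 0) fun j => by
      split_ifs <;> norm_num
    have hm0 := (majority (t + (k + 1)) B).prob_nonneg id (i, j₀)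
    have hm := le_majority_prob B (i, j₀) (t + (k + 1)) h
    have hP := flagWeight_nonneg t B i k (f := fun _ => 1) fun _ => zero_le_one
    have hS : 0 ≤ ∑ l ∈ Finset.range k, flagWeight t B i l fun _ => 1 :=
      Finset.sum_nonneg fun l _ => flagWeight_nonneg t B i l fun _ => zero_le_one
    have hD : 0 ≤ ∑ l ∈ Finset.range (k + 1), (2 / 5 : ℝ) ^ (t + l) / 10 :=
      Finset.sum_nonneg fun l _ => by positivity
    have hd : (0 : ℝ) ≤ (2 / 5) ^ (t + (k + 1)) / 10 := by positivity
    have e : (fun j => (majority (t + (k + 1)) B).prob id (i, j) * if j = j₀ then 1 else 0) =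
        fun j => (majority (t + (k + 1)) B).prob id (i, j₀) * if j = j₀ then 1 else 0 := by
      funext j
      split_ifs with hj
      · rw [hj]
      · simp
    rw [flagWeight_succ, e, flagWeight_const_mul,
      Finset.sum_range_succ (fun l => (2 / 5 : ℝ) ^ (t + l) / 10) (k + 1),
      Finset.sum_range_succ (fun l => flagWeight t B i l fun _ => 1) k]
    set u := flagWeight t B i k fun j => if j = j₀ then 1 else 0
    set P := flagWeight t B i k fun _ => 1
    set m := (majority (t + (k + 1)) B).prob id (i, j₀)
    set S := ∑ l ∈ Finset.range k, flagWeight t B i l fun _ => 1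
    set Δ := ∑ l ∈ Finset.range (k + 1), (2 / 5 : ℝ) ^ (t + l) / 10
    set δ := (2 / 5 : ℝ) ^ (t + (k + 1)) / 10
    -- If the losses exceed `1`, the bound is trivial; otherwise all factors below are nonnegative.
    rcases le_total (1 - (Δ + δ) - 8 / 3 * (S + P)) 0 with hx | hx
    · exact (mul_nonpos_of_nonneg_of_nonpos (by positivity) hx).trans (by positivity)
    · set x := 1 - Δ - 8 / 3 * S with hx'
      have hx1 : 0 ≤ x := by linarith
      have hab : 0 ≤ 1 - δ - 8 / 3 * P := by linarith
      have h1 : 9 * (1 - 8 / 3 * P) ≤ (3 - 4 * P) ^ 2 := by nlinarith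
      calc 9 ^ (k + 1) * (1 - (Δ + δ) - 8 / 3 * (S + P))
          = 9 ^ (k + 1) * (x - δ - 8 / 3 * P) := by ring
        _ ≤ 9 ^ (k + 1) * ((1 - 8 / 3 * P) * (1 - δ) * x) := by
            gcongr
            have h2 : 1 - δ - 8 / 3 * P ≤ (1 - 8 / 3 * P) * (1 - δ) := by
              nlinarith [mul_nonneg hP hd]
            have h3 : x ≤ 1 := by linarith
            nlinarith [mul_le_mul_of_nonneg_right h2 hx1]
        _ = 9 * (1 - 8 / 3 * P) * (1 - δ) * (9 ^ k * x) := by ring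
        _ ≤ (3 - 4 * P) ^ 2 * m * (N * u) := by
            gcongr
            · linarith
        _ = _ := by ring

/-- Quantum search rarely misses a good index. -/
theorem search_none_le {t : ℕ} (ht : 10 ≤ t) (j₀ : Fin N) (h : 9 / 10 ≤ B.prob id (i, j₀)) :
    (search t B).expect i (fun r => r.elim 1 fun _ => 0) ≤ 1 / 1000 := by
  have hN : (0 : ℝ) < N := Nat.cast_pos.mpr (Nat.pos_of_neZero N)
  set K := Nat.clog 9 N with hK
  set P : ℕ → ℝ := fun k => flagWeight t B i k fun _ => 1 with hP
  have hP0 : ∀ k, 0 ≤ P k := fun k => flagWeight_nonneg t B i k fun _ => zero_le_one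
  -- At stage `K`, `9 ^ K ≥ N` turns the growth bound into `1 - Δ - 8/3 S ≤ P K` with `Δ ≤ 1/100`.
  -- Flagged weight from any index counts, so ambiguous indices only help.
  have hsum : 1 / 4 ≤ ∑ k ∈ Finset.range (K + 1), P k := by
    have h1 := le_flagWeight_of_good t B i j₀ h K
    have h2 : flagWeight t B i K (fun j => if j = j₀ then 1 else 0) ≤ P K :=
      flagWeight_mono t B i K fun j => by split_ifs <;> norm_num
    have h3 : (N : ℝ) ≤ 9 ^ K := by exact_mod_cast Nat.le_pow_clog (by norm_num) N
    have h4 : ∑ l ∈ Finset.range (K + 1), (2 / 5 : ℝ) ^ (t + l) / 10 ≤ 1 / 100 := by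
      have h5 := two_fifths_pow_le ht
      have e : ∀ l ∈ Finset.range (K + 1), (2 / 5 : ℝ) ^ (t + l) / 10 =
          (2 / 5) ^ t / 10 * (2 / 5) ^ l := fun l _ => by rw [pow_add]; ring
      rw [Finset.sum_congr rfl e, ← Finset.mul_sum, geom_sum_eq (by norm_num)]
      have h6 : (0 : ℝ) ≤ (2 / 5) ^ (K + 1) := by positivity
      have h7 : ((2 / 5 : ℝ) ^ (K + 1) - 1) / (2 / 5 - 1) ≤ 5 / 3 := by
        rw [div_le_iff_of_neg (by norm_num)]
        linarith
      calc _ ≤ (2 / 5 : ℝ) ^ t / 10 * (5 / 3) := by gcongr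
        _ ≤ _ := by linarith
    rw [Finset.sum_range_succ]
    set S := ∑ l ∈ Finset.range K, P l
    set Δ := ∑ l ∈ Finset.range (K + 1), (2 / 5 : ℝ) ^ (t + l) / 10
    have h8 : 1 - Δ - 8 / 3 * S ≤ P K := by
      rcases le_total (1 - Δ - 8 / 3 * S) 0 with hx | hx
      · exact hx.trans (hP0 K)
      · refine le_of_mul_le_mul_left ?_ hN
        calc N * (1 - Δ - 8 / 3 * S) ≤ 9 ^ K * (1 - Δ - 8 / 3 * S) := by gcongr
          _ ≤ _ := h1
          _ ≤ N * P K := by gcongr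
    have := hP0 K
    linarith
  rw [search, expect_map]
  refine le_trans (expect_mono (g := fun o => ∏ k,
    (1 - if (o k).2 = true then 1 else 0)) _ _ fun o => ?_) ?_
  · rw [Function.comp_apply]
    rcases h : (List.ofFn o).find? Prod.snd with _ | a
    · rw [List.find?_eq_none] at h
      refine le_of_eq ?_
      symm
      refine Finset.prod_eq_one fun k _ => ?_
      rw [if_neg (h _ ((List.mem_ofFn' o _).mpr ⟨k, rfl⟩)), sub_zero]
    · exact Finset.prod_nonneg fun k _ => by split_ifs <;> norm_num
  · rw [expect_par_prod (fun k : Fin (40 * (K + 1)) => searchStage t B ((k : ℕ) / 40)) i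
      fun _ o => 1 - if o.2 = true then 1 else 0]
    have h1 : ∀ k : Fin (40 * (K + 1)), (searchStage t B ((k : ℕ) / 40)).expect i
        (fun o => 1 - if o.2 = true then 1 else 0) = 1 - P ((k : ℕ) / 40) := fun k =>
      expect_one_sub _ _ _
    calc _ = ∏ k : Fin (40 * (K + 1)), (1 - P ((k : ℕ) / 40)) :=
          Finset.prod_congr rfl fun k _ => h1 k
      _ ≤ ∏ k : Fin (40 * (K + 1)), Real.exp (-P ((k : ℕ) / 40)) :=
          Finset.prod_le_prod
            (fun k _ => sub_nonneg.mpr (flagWeight_one_le t B i _))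
            fun k _ => Real.one_sub_le_exp_neg _
      _ = Real.exp (-(40 * ∑ k ∈ Finset.range (K + 1), P k)) := by
          rw [← Real.exp_sum, Finset.sum_neg_distrib, sum_fin_mul_div 40 _ (by norm_num) P]
          norm_num
      _ ≤ Real.exp (-10) := Real.exp_le_exp.mpr (by linarith)
      _ ≤ 1 / 1000 := by
          rw [Real.exp_neg, ← one_div]
          refine one_div_le_one_div_of_le (by norm_num) ?_
          have h2 : (2 : ℝ) ≤ Real.exp 1 := by
            have := Real.add_one_le_exp (1 : ℝ)
            linarith
          calc (1000 : ℝ) ≤ 2 ^ 10 := by norm_num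
            _ ≤ Real.exp 1 ^ 10 := by gcongr
            _ = Real.exp 10 := by rw [← Real.exp_nat_mul]; norm_num

end Search

end QAlg

theorem PMF.toOuterMeasure_le_one {α : Type*} (P : PMF α) (S : Set α) :
    P.toOuterMeasure S ≤ 1 := by
  rw [← (P.toOuterMeasure_apply_eq_one_iff Set.univ).mpr (Set.subset_univ _)]
  exact MeasureTheory.measure_mono (Set.subset_univ S)

namespace QAlg

/-! ### Quantum guessing -/

section Guess

variable {N : ℕ} [NeZero N] (B : QAlg (Fin N) Bool)

instance neZero_min_two_pow (k : ℕ) : NeZero (min (2 ^ k) N) :=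
  ⟨(Nat.lt_min.mpr ⟨Nat.two_pow_pos k, Nat.pos_of_neZero N⟩).ne'⟩

/-- The output of stage `k` of quantum guessing. -/
noncomputable def guessStage (k : ℕ) : PMF (Option (Fin (min (2 ^ k) N))) :=
  (search (10 + k) (initial B (2 ^ k))).run ()

/-- The loop goes on only after an empty search. Since `S` may contain `none`, this serves both
guarantees. -/
theorem guessLoop_cons_toOuterMeasure_le (k : ℕ) (ks : List ℕ) (bad : Fin N → Prop)
    (S : Set (Option (Fin N))) (hS : ∀ j, some j ∈ S → bad j) :
    (guessLoop B (k :: ks)).toOuterMeasure S ≤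
      (guessStage B k).toOuterMeasure {none} * (guessLoop B ks).toOuterMeasure S +
      (guessStage B k).toOuterMeasure
        {r | ∃ j, r = some j ∧ bad (Fin.castLE (Nat.min_le_right _ _) j)} := by
  classical
  have h : guessLoop B (k :: ks) = (guessStage B k).bind fun r =>
      match r with
      | some i => PMF.pure (some (Fin.castLE (Nat.min_le_right _ _) i))
      | none => guessLoop B ks := rfl
  rw [h, PMF.toOuterMeasure_bind_apply, tsum_fintype, Fintype.sum_option,
    PMF.toOuterMeasure_apply_singleton, PMF.toOuterMeasure_apply (guessStage B k), tsum_fintype,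
    Fintype.sum_option]
  refine add_le_add le_rfl (le_add_left (Finset.sum_le_sum fun j _ => ?_))
  rw [PMF.toOuterMeasure_pure_apply]
  split_ifs with hj
  · have hmem : some j ∈ {r : Option (Fin (min (2 ^ k) N)) |
        ∃ j, r = some j ∧ bad (Fin.castLE (Nat.min_le_right _ _) j)} := ⟨j, rfl, hS _ hj⟩
    rw [Set.indicator_of_mem hmem, mul_one]
  · simp

theorem guessStage_bad_le (bad : Fin N → Prop) (hbad : ∀ j, bad j → B.prob id j ≤ 1 / 10)
    (k : ℕ) :
    (guessStage B k).toOuterMeasure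
      {r | ∃ j, r = some j ∧ bad (Fin.castLE (Nat.min_le_right _ _) j)} ≤
      ENNReal.ofReal (5 * (2 / 5) ^ (10 + k)) := by
  classical
  rw [guessStage, run_toOuterMeasure]
  refine ENNReal.ofReal_le_ofReal (le_trans (le_of_eq ?_) (search_bad_le (initial B (2 ^ k)) ()
    (Nat.le_add_right 10 k) (fun j => bad (Fin.castLE (Nat.min_le_right _ _) j))
    fun j hj => hbad _ hj))
  congr 1
  funext r
  cases r <;> simp

theorem guessStage_none_le (j₀ : Fin N) (h : 9 / 10 ≤ B.prob id j₀) :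
    (guessStage B (Nat.clog 2 N)).toOuterMeasure {none} ≤ ENNReal.ofReal (1 / 1000) := by
  classical
  have hj : (j₀ : ℕ) < min (2 ^ Nat.clog 2 N) N :=
    lt_min (j₀.2.trans_le (Nat.le_pow_clog one_lt_two N)) j₀.2
  rw [guessStage, run_toOuterMeasure]
  refine ENNReal.ofReal_le_ofReal (le_trans (le_of_eq ?_) (search_none_le
    (initial B (2 ^ Nat.clog 2 N)) () (Nat.le_add_right 10 (Nat.clog 2 N)) ⟨j₀, hj⟩ h))
  congr 1
  funext r
  cases r <;> simp

theorem guessLoop_bad_le (bad : Fin N → Prop) (hbad : ∀ j, bad j → B.prob id j ≤ 1 / 10)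
    (S : Set (Option (Fin N))) (hS : ∀ j, some j ∈ S → bad j) (hn : none ∉ S) (l : List ℕ) :
    (guessLoop B l).toOuterMeasure S ≤
      (l.map fun k => ENNReal.ofReal (5 * (2 / 5) ^ (10 + k))).sum := by
  classical
  induction l with
  | nil => simp [guessLoop, hn]
  | cons k ks ih =>
    rw [List.map_cons, List.sum_cons, add_comm]
    refine (guessLoop_cons_toOuterMeasure_le B k ks bad S hS).trans
      (add_le_add ?_ (guessStage_bad_le B bad hbad k))
    exact (mul_le_of_le_one_left' (PMF.toOuterMeasure_le_one _ _)).trans ih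

/-- Earlier rounds may come up empty at no cost. Only the round that covers all `N` guesses must
succeed, and it is charged `1/1000`. -/
theorem guessLoop_fail_le (bad : Fin N → Prop) (hbad : ∀ j, bad j → B.prob id j ≤ 1 / 10)
    (j₀ : Fin N) (h : 9 / 10 ≤ B.prob id j₀)
    (S : Set (Option (Fin N))) (hS : ∀ j, some j ∈ S → bad j) (l : List ℕ)
    (hl : Nat.clog 2 N ∈ l) :
    (guessLoop B l).toOuterMeasure S ≤ ENNReal.ofReal (1 / 1000) +
      (l.map fun k => ENNReal.ofReal (5 * (2 / 5) ^ (10 + k))).sum := by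
  induction l with
  | nil => simp at hl
  | cons k ks ih =>
    rw [List.map_cons, List.sum_cons, add_comm (ENNReal.ofReal (5 * _)), ← add_assoc]
    refine (guessLoop_cons_toOuterMeasure_le B k ks bad S hS).trans
      (add_le_add ?_ (guessStage_bad_le B bad hbad k))
    rcases List.mem_cons.mp hl with rfl | hk
    · exact (mul_le_of_le_one_right' (PMF.toOuterMeasure_le_one _ _)).trans
        ((guessStage_none_le B j₀ h).trans le_self_add)
    · exact (mul_le_of_le_one_left' (PMF.toOuterMeasure_le_one _ _)).trans (ih hk)

theorem sum_guess_error_le (n : ℕ) :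
    ((List.range n).map fun k => ENNReal.ofReal (5 * (2 / 5) ^ (10 + k))).sum ≤
      ENNReal.ofReal (1 / 100) := by
  have h : ∀ f : ℕ → ENNReal, ((List.range n).map f).sum = ∑ k ∈ Finset.range n, f k := by
    intro f
    induction n with
    | zero => simp
    | succ n ih => simp [List.range_succ, Finset.sum_range_succ, ih]
  rw [h, ← ENNReal.ofReal_sum_of_nonneg fun k _ => by positivity]
  refine ENNReal.ofReal_le_ofReal ?_
  have e : ∀ k ∈ Finset.range n, (5 * (2 / 5) ^ (10 + k) : ℝ) =
      5 * (2 / 5) ^ 10 * (2 / 5) ^ k := fun k _ => by rw [pow_add]; ring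
  rw [Finset.sum_congr rfl e, ← Finset.mul_sum, geom_sum_eq (by norm_num)]
  have h6 : (0 : ℝ) ≤ (2 / 5) ^ n := by positivity
  have h7 : ((2 / 5 : ℝ) ^ n - 1) / (2 / 5 - 1) ≤ 5 / 3 := by
    rw [div_le_iff_of_neg (by norm_num)]
    linarith
  calc _ ≤ 5 * (2 / 5 : ℝ) ^ 10 * (5 / 3) := by gcongr
    _ ≤ _ := by norm_num

theorem guess_bad_le (bad : Fin N → Prop) (hbad : ∀ j, bad j → B.prob id j ≤ 1 / 10)
    (S : Set (Option (Fin N))) (hS : ∀ j, some j ∈ S → bad j) (hn : none ∉ S) :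
    (guess B).toOuterMeasure S ≤ ENNReal.ofReal (1 / 10) :=
  (guessLoop_bad_le B bad hbad S hS hn _).trans
    ((sum_guess_error_le _).trans (ENNReal.ofReal_le_ofReal (by norm_num)))

theorem guess_fail_le (bad : Fin N → Prop) (hbad : ∀ j, bad j → B.prob id j ≤ 1 / 10)
    (j₀ : Fin N) (h : 9 / 10 ≤ B.prob id j₀)
    (S : Set (Option (Fin N))) (hS : ∀ j, some j ∈ S → bad j) :
    (guess B).toOuterMeasure S ≤ ENNReal.ofReal (1 / 10) := by
  refine (guessLoop_fail_le B bad hbad j₀ h S hS _ (by simp)).trans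
    ((add_le_add le_rfl (sum_guess_error_le _)).trans ?_)
  rw [← ENNReal.ofReal_add (by norm_num) (by norm_num)]
  exact ENNReal.ofReal_le_ofReal (by norm_num)

end Guess

end QAlg

theorem PMF.le_toOuterMeasure_of_compl_le {α : Type*} (P : PMF α) (S : Set α)
    (h : P.toOuterMeasure Sᶜ ≤ ENNReal.ofReal (1 / 10)) : 9 / 10 ≤ P.toOuterMeasure S := by
  have h1 : (1 : ENNReal) ≤ P.toOuterMeasure S + P.toOuterMeasure Sᶜ := by
    rw [← (P.toOuterMeasure_apply_eq_one_iff Set.univ).mpr (Set.subset_univ _),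
      ← Set.union_compl_self S]
    exact MeasureTheory.measure_union_le _ _
  have h2 : (9 / 10 : ENNReal) + ENNReal.ofReal (1 / 10) = 1 := by
    rw [show (9 / 10 : ENNReal) = ENNReal.ofReal (9 / 10) by
      rw [ENNReal.ofReal_div_of_pos (by norm_num)]; norm_num,
      ← ENNReal.ofReal_add (by norm_num) (by norm_num)]
    norm_num
  refine (ENNReal.add_le_add_iff_right (ENNReal.ofReal_ne_top (r := 1 / 10))).mp ?_
  rw [h2]
  exact h1.trans (add_le_add le_rfl h)

/-! ### The oracles of the dual attack -/

namespace DualAttack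

variable {m kenum kfft klat p q D : ℕ}

/-- The factor `1/ψ` is the pure phase `exp (2 π i θ / p)`; it enters each exponent as the `θ` in
the last coordinate of the oracle vector. -/
theorem score_eq_sum_cos {α : ℝ} {A : Matrix (Fin m) (Fin (kenum + kfft + klat)) (ZMod q)}
    (b : Fin m → ZMod q) (L : Fin D → DualVector α A)
    (senum : Fin kenum → ZMod q) (sfft : Fin kfft → ZMod p) :
    score b L senum sfft = ∑ j, Real.cos (2 * Real.pi *
      (oracleVector b L sfft j ⬝ᵥ guessVector senum sfft) / p) := by
  rw [score, Finset.mul_sum, Complex.re_sum]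
  refine Finset.sum_congr rfl fun j _ => ?_
  rw [psi, one_div, ← Complex.exp_neg, ← Complex.exp_add, ← Complex.exp_ofReal_mul_I_re]
  congr 2
  simp only [dotProduct, oracleVector, guessVector, theta, Fintype.sum_sum_type, Sum.elim_inl,
    Sum.elim_inr, Finset.univ_unique, Finset.sum_singleton, mul_one]
  simp only [mul_assoc ((p : ℝ) / q), ← Finset.mul_sum]
  push_cast
  ring

variable [NeZero D] {α : ℝ}
  {A : Matrix (Fin m) (Fin (kenum + kfft + klat)) (ZMod q)}
  (b : Fin m → ZMod q) (L : Fin D → DualVector α A) {C η : ℝ}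
  (senum : Fin kenum → ZMod q) (sfft : Fin kfft → ZMod p)

theorem estimate_error_le (hC : 0 < C) (hη : 0 < η) :
    (QAlg.meanCos (p : ℝ) (fun s : (Fin kenum → ZMod q) × (Fin kfft → ZMod p) =>
      oracleVector b L s.2) (fun s => guessVector s.1 s.2)
      (C / D * η) (1 / 10)).expect (senum, sfft)
      (fun e => if C / D * η < |e - score b L senum sfft / D| then 1 else 0) ≤ 1 / 10 := by
  have hD : (0 : ℝ) < D := Nat.cast_pos.mpr (Nat.pos_of_neZero D)
  rw [score_eq_sum_cos]
  exact QAlg.meanCos_error_le (p : ℝ) (fun s : (Fin kenum → ZMod q) × (Fin kfft → ZMod p) =>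
    oracleVector b L s.2) (fun s => guessVector s.1 s.2) (by positivity) (senum, sfft)

variable [NeZero p]

/-- The threshold exceeds `C / D` by exactly the precision `η C / D`, so acceptance forces an
estimation error. -/
theorem fftOracle_prob_le (hC : 0 < C) (hη : 0 < η) (h : score b L senum sfft ≤ C) :
    (fftOracle b L C η).prob id (senum, sfft) ≤ 1 / 10 := by
  have hD : (0 : ℝ) < D := Nat.cast_pos.mpr (Nat.pos_of_neZero D)
  rw [QAlg.prob, fftOracle, QAlg.expect_map]
  refine le_trans (QAlg.expect_mono _ _ fun e => ?_) (estimate_error_le b L senum sfft hC hη)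
  have h1 : score b L senum sfft / D ≤ C / D := by gcongr
  simp only [id, Function.comp_apply, decide_eq_true_eq]
  split_ifs with ha hb
  · exact le_rfl
  · have := le_abs_self (e - score b L senum sfft / D)
    refine absurd ?_ hb
    linarith
  all_goals norm_num

theorem le_fftOracle_prob (hC : 0 < C) (hη : 0 < η)
    (h : (1 + 2 * η) * C < score b L senum sfft) :
    9 / 10 ≤ (fftOracle b L C η).prob id (senum, sfft) := by
  have hD : (0 : ℝ) < D := Nat.cast_pos.mpr (Nat.pos_of_neZero D)
  have h1 : (1 + 2 * η) * (C / D) < score b L senum sfft / D := by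
    rw [← mul_div_assoc]
    gcongr
  have h2 : 1 - (fftOracle b L C η).prob id (senum, sfft) ≤ 1 / 10 := by
    rw [QAlg.prob, fftOracle, QAlg.expect_map, ← QAlg.expect_one_sub]
    refine le_trans (QAlg.expect_mono _ _ fun e => ?_) (estimate_error_le b L senum sfft hC hη)
    simp only [id, Function.comp_apply, decide_eq_true_eq]
    split_ifs with ha hb hb
    · norm_num
    · norm_num
    · norm_num
    · have := neg_abs_le (e - score b L senum sfft / D)
      refine absurd ?_ hb
      linarith
  linarith

theorem enumOracle_prob_le (hC : 0 < C) (hη : 0 < η) (h : senum ∉ goodGuesses p b L C) :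
    (enumOracle p b L C η).prob id senum ≤ 1 / 10 := by
  have hs : ∀ sfft : Fin kfft → ZMod p, score b L senum sfft ≤ C := fun sfft =>
    not_lt.mp fun hlt => h ⟨sfft, hlt⟩
  -- Outside `S_C` every `s_fft` is bad, so the predicate `True` counts every nonempty search
  -- result.
  refine le_trans (le_of_eq ?_) ((QAlg.search_bad_le ((fftOracle b L C η).comap
    fun s : (Fin kenum → ZMod q) × Fin (p ^ kfft) => (s.1, fftEnum p kfft s.2)) senum (t := 10)
    le_rfl (fun _ => True) fun j _ =>
      fftOracle_prob_le b L senum (fftEnum p kfft j) hC hη (hs _)).trans (by norm_num))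
  rw [QAlg.prob, enumOracle, QAlg.expect_map]
  congr 1
  funext r
  cases r <;> simp

theorem le_enumOracle_prob (hC : 0 < C) (hη : 0 < η)
    (h : senum ∈ goodGuesses p b L ((1 + 2 * η) * C)) :
    9 / 10 ≤ (enumOracle p b L C η).prob id senum := by
  obtain ⟨sfft, hs⟩ := h
  have h1 : 1 - (enumOracle p b L C η).prob id senum ≤ 1 / 1000 := by
    refine le_trans (le_of_eq ?_) (QAlg.search_none_le ((fftOracle b L C η).comap
      fun s : (Fin kenum → ZMod q) × Fin (p ^ kfft) => (s.1, fftEnum p kfft s.2)) senum (t := 10)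
      le_rfl ((fftEnum p kfft).symm sfft) (by
        have := le_fftOracle_prob b L senum sfft hC hη hs
        rw [← (fftEnum p kfft).apply_symm_apply sfft] at this
        exact this))
    rw [QAlg.prob, enumOracle, QAlg.expect_map, ← QAlg.expect_one_sub]
    congr 1
    funext r
    cases r <;> simp
  linarith

end DualAttack

/-! ### The guarantee for the whole attack -/

theorem mainTheorem5 {m kenum kfft klat p q D : ℕ} [NeZero p] [NeZero q] [NeZero D]
    (hpq : p ≤ q) (χs χe : PMF (ZMod q))
    (A : Matrix (Fin m) (Fin (kenum + kfft + klat)) (ZMod q)) (b : Fin m → ZMod q)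
    (C η : ℝ) (hC : 0 < C) (hη0 : 0 < η) (hη1 : η ≤ 1)
    (ord : Fin (q ^ kenum) ≃ (Fin kenum → ZMod q))
    (hord : ∀ i j, i ≤ j → ∏ t, χs (ord j t) ≤ ∏ t, χs (ord i t))
    (L : Fin D → DualAttack.DualVector (DualAttack.stdDev χe / DualAttack.stdDev χs) A) :
    9 / 10 ≤ (DualAttack.attack p b L C η ord).toOuterMeasure
        {r | r = none ∨ ∃ s ∈ DualAttack.goodGuesses p b L C, r = some s} ∧
      ((DualAttack.goodGuesses p b L ((1 + 2 * η) * C)).Nonempty →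
        9 / 10 ≤ (DualAttack.attack p b L C η ord).toOuterMeasure
          {r | ∃ s ∈ DualAttack.goodGuesses p b L C, r = some s}) := by
  have hbad : ∀ j, ord j ∉ DualAttack.goodGuesses p b L C →
      ((DualAttack.enumOracle p b L C η).comap ord).prob id j ≤ 1 / 10 := fun j hj =>
    DualAttack.enumOracle_prob_le b L (ord j) hC hη0 hj
  constructor
  · refine PMF.le_toOuterMeasure_of_compl_le _ _ ?_
    rw [DualAttack.attack, PMF.toOuterMeasure_map_apply]
    refine QAlg.guess_bad_le _ (fun j => ord j ∉ DualAttack.goodGuesses p b L C) hbad _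
      (fun j hj hg => hj (Or.inr ⟨ord j, hg, rfl⟩)) fun hn => hn (Or.inl rfl)
  · rintro ⟨s, hs⟩
    refine PMF.le_toOuterMeasure_of_compl_le _ _ ?_
    rw [DualAttack.attack, PMF.toOuterMeasure_map_apply]
    refine QAlg.guess_fail_le _ (fun j => ord j ∉ DualAttack.goodGuesses p b L C) hbad
      (ord.symm s) ?_ _ fun j hj hg => hj ⟨ord j, hg, rfl⟩
    have h := DualAttack.le_enumOracle_prob b L s hC hη0 hs
    rw [← ord.apply_symm_apply s] at h
    exact h
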